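/- For $n\in\mathbb Z_+$, $d\ge 2$, $\alpha,\beta\in(0,1)$ and $R>0$, the contextual stochastic block model $\mathrm{CSBM}(n,d,\alpha,\beta,R)$ is the law of $(y,\mu,A,\{x_i\}_{i=1}^n)$ generated as follows. * The label vector $y$ is uniform on $\{\pm1\}^n$, and $\mu$ is uniform on the sphere $\{u\in\mathbb R^d:\|u\|_2=R\}$, independently of $y$. * Given $(y,\mu)$, the network $A$ and the attributes $\{x_i\}_{i=1}^n$ are independent. The matrix $A\in\{0,1\}^{n\times n}$ is symmetric with zero diagonal, and its entries $A_{ij}$, $i<j$, are independent with $\mathbb P(A_{ij}=1)=\alpha$ if $y_i=y_j$ and $\mathbb P(A_{ij}=1)=\beta$ if $y_i\ne y_j$. The attributes are $x_i=y_i\mu+z_i$ with $z_1,\dots,z_n$ i.i.d. $N(0,I_d)$. For $u,v\in\{\pm1\}^n$ let $$\mathcal M(u,v)=\frac1n\min_{s=\pm1}\bigl|\{i\in[n]:u_i\neq s\,v_i\}\bigr|$$ be the misclassification rate up to a global sign flip, and let $$I^*(a,b,c)=\frac{(\sqrt a-\sqrt b)^2+c}{2}.$$ **Theorem.** Let $a,b,c>0$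 be constants, and let $(q_n)$, $(R_n)$ be real sequences and $(d_n)$ a sequence of integers such that $q_n\to\infty$ and, for all sufficiently large $n$, $q_n\le\log n$, $d_n\ge2$, $R_n>0$ and $R_n^4/(R_n^2+d_n/n)=c\,q_n$. Put $\alpha_n=aq_n/n$ and $\beta_n=bq_n/n$ (both lie in $(0,1)$ for large $n$), and for each such $n$ let $(y,\mu,A,\{x_i\}_{i=1}^n)\sim\mathrm{CSBM}(n,d_n,\alpha_n,\beta_n,R_n)$. Then for every sequence of estimators $\hat y=\hat y_n(A,\{x_i\}_{i=1}^n)\in\{\pm1\}^n$, that is, measurable functions of the data, which may depend on $n,a,b,c,q_n,d_n,R_n$, $$\liminf_{n\to\infty}\ q_n^{-1}\log\mathbb E\,\mathcal M(\hat y,y)\ \ge\ -I^*(a,b,c),$$ with the convention $\log0=-\infty$. -/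

import Mathlib

open MeasureTheory ProbabilityTheory Filter Topology

noncomputable section

namespace CSBM

/-- Label vectors in `{±1}^n`. -/
abbrev Labels (n : ℕ) : Type := Fin n → ℤˣ

/-- Adjacency matrices in `{0,1}^{n×n}`. -/
abbrev Adj (n : ℕ) : Type := Fin n → Fin n → Fin 2

/-- Node attributes: `n` vectors in Euclidean `ℝ^d`. -/
abbrev Attr (n d : ℕ) : Type := Fin n → EuclideanSpace ℝ (Fin d)

/-- The unordered pairs `{i, j}` of distinct nodes, encoded by `i < j`. -/
abbrev Pairs (n : ℕ) : Type := {p : Fin n × Fin n // p.1 < p.2}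

instance instDiscreteIntUnits : DiscreteMeasurableSpace ℤˣ :=
  ⟨fun s => ⟨Units.val '' s, trivial, Set.preimage_image_eq s Units.val_injective⟩⟩

/-- The Bernoulli distribution on `{0,1}` with success probability `p ∈ [0,1]`. -/
def bernoulliLaw (p : ℝ) : Measure (Fin 2) :=
  p.toNNReal • Measure.dirac 1 + (1 - p).toNNReal • Measure.dirac 0

instance instFiniteBernoulliLaw (p : ℝ) : IsFiniteMeasure (bernoulliLaw p) := by
  unfold bernoulliLaw; infer_instance

/-- The symmetric matrix with zero diagonal whose entries above the diagonal are given by `e`. -/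
def symmetrize {n : ℕ} (e : Pairs n → Fin 2) : Adj n := fun i j =>
  if h : i < j then e ⟨(i, j), h⟩ else if h : j < i then e ⟨(j, i), h⟩ else 0

/-- The stochastic block model `SBM(y, α, β)`: independent edges, present with probability `α`
inside a block and `β` across blocks. -/
def sbm {n : ℕ} (y : Labels n) (α β : ℝ) : Measure (Adj n) :=
  (Measure.pi fun p : Pairs n =>
    bernoulliLaw (if y p.1.1 = y p.1.2 then α else β)).map symmetrize

/-- The attributes `x_i = y_i μ + z_i`. -/
def shift {n d : ℕ} (μ : EuclideanSpace ℝ (Fin d)) (y : Labels n) (z : Attr n d) : Attr n d :=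
  fun i => ((y i : ℤ) : ℝ) • μ + z i

/-- The Gaussian mixture model `GMM(μ, y)`: `x_i = y_i μ + z_i` with `z_i` i.i.d. `N(0, I_d)`. -/
def gmm {n d : ℕ} (μ : EuclideanSpace ℝ (Fin d)) (y : Labels n) : Measure (Attr n d) :=
  (Measure.pi fun _ : Fin n => stdGaussian (EuclideanSpace ℝ (Fin d))).map (shift μ y)

/-- The uniform distribution on `{±1}^n`. -/
def labelPrior (n : ℕ) : Measure (Labels n) :=
  (PMF.uniformOfFintype (Labels n)).toMeasure

/-- The uniform distribution on the sphere of radius `R` in `ℝ^d`: the normalized surface measure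
of the unit sphere, scaled by `R`. -/
def spherePrior (d : ℕ) (R : ℝ) : Measure (EuclideanSpace ℝ (Fin d)) :=
  let σ := (volume : Measure (EuclideanSpace ℝ (Fin d))).toSphere
  ((σ Set.univ)⁻¹ • σ).map
    (fun u : Metric.sphere (0 : EuclideanSpace ℝ (Fin d)) 1 => R • (u : EuclideanSpace ℝ (Fin d)))

theorem measurable_symmetrize {n : ℕ} : Measurable (symmetrize (n := n)) :=
  Measurable.of_discrete

theorem measurable_shift {n d : ℕ} (y : Labels n) :
    Measurable (fun p : EuclideanSpace ℝ (Fin d) × Attr n d => shift p.1 y p.2) := by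
  unfold shift
  fun_prop

instance instFiniteSbm {n : ℕ} (y : Labels n) (α β : ℝ) : IsFiniteMeasure (sbm y α β) := by
  unfold sbm; infer_instance

instance instProbGmm {n d : ℕ} (μ : EuclideanSpace ℝ (Fin d)) (y : Labels n) :
    IsProbabilityMeasure (gmm μ y) :=
  Measure.isProbabilityMeasure_map
    ((measurable_shift y).comp measurable_prodMk_left).aemeasurable

theorem measurable_sbm_prod_gmm (n d : ℕ) (α β : ℝ) :
    Measurable fun θ : Labels n × EuclideanSpace ℝ (Fin d) =>
      (sbm θ.1 α β).prod (gmm θ.2 θ.1) := by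
  refine measurable_from_prod_countable_right fun y => ?_
  let κ : Kernel (EuclideanSpace ℝ (Fin d)) (Attr n d) :=
    (Kernel.id ×ₖ Kernel.const _
      (Measure.pi fun _ : Fin n => stdGaussian (EuclideanSpace ℝ (Fin d)))).map
      (fun p => shift p.1 y p.2)
  have hκ : ∀ μ, κ μ = gmm μ y := fun μ => by
    rw [Kernel.map_apply _ (measurable_shift y), Kernel.prod_apply, Kernel.id_apply,
      Kernel.const_apply, Measure.dirac_prod, Measure.map_map (measurable_shift y)
      measurable_prodMk_left]
    rfl
  have : IsSFiniteKernel κ := by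
    dsimp only [κ]; infer_instance
  have h := (Kernel.const (EuclideanSpace ℝ (Fin d)) (sbm y α β) ×ₖ κ).measurable
  have e : (⇑(Kernel.const (EuclideanSpace ℝ (Fin d)) (sbm y α β) ×ₖ κ)) =
      fun μ => (sbm y α β).prod (gmm μ y) := by
    funext μ
    rw [Kernel.prod_apply, Kernel.const_apply, hκ]
  rw [e] at h
  exact h

/-- The conditional law of `(A, X)` given `(y, μ)`: independent `SBM(y, α, β)` and
`GMM(μ, y)`. -/
def csbmKernel (n d : ℕ) (α β : ℝ) :
    Kernel (Labels n × EuclideanSpace ℝ (Fin d)) (Adj n × Attr n d) where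
  toFun θ := (sbm θ.1 α β).prod (gmm θ.2 θ.1)
  measurable' := measurable_sbm_prod_gmm n d α β

instance instFiniteCsbmKernel (n d : ℕ) (α β : ℝ) : IsFiniteKernel (csbmKernel n d α β) := by
  refine ⟨⟨∑ y : Labels n, sbm y α β Set.univ,
    ENNReal.sum_lt_top.2 fun y _ => measure_lt_top _ _, fun θ => ?_⟩⟩
  change ((sbm θ.1 α β).prod (gmm θ.2 θ.1)) Set.univ ≤ _
  rw [← Set.univ_prod_univ, Measure.prod_prod, measure_univ (μ := gmm θ.2 θ.1),
    mul_one]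
  exact Finset.single_le_sum (f := fun y : Labels n => sbm y α β Set.univ)
    (fun _ _ => zero_le) (Finset.mem_univ θ.1)

/-- The joint law of `((y, μ), (A, X))` under `CSBM(n, d, α, β, R)`. -/
def csbm (n d : ℕ) (α β R : ℝ) :
    Measure ((Labels n × EuclideanSpace ℝ (Fin d)) × (Adj n × Attr n d)) :=
  ((labelPrior n).prod (spherePrior d R)) ⊗ₘ csbmKernel n d α β

/-- The misclassification rate
`M(u, v) = n⁻¹ min_{s = ±1} #{i : u_i ≠ s v_i}`. -/
def mismatch {n : ℕ} (u v : Labels n) : ℝ :=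
  (n : ℝ)⁻¹ * min ((Finset.univ.filter fun i => u i ≠ v i).card : ℝ)
    ((Finset.univ.filter fun i => u i ≠ -v i).card : ℝ)

/-- The expected misclassification rate `E M(ŷ(A, X), y)` under `CSBM(n, d, α, β, R)`. -/
def risk (n d : ℕ) (α β R : ℝ) (yhat : Adj n × Attr n d → Labels n) : ENNReal :=
  ∫⁻ ω, ENNReal.ofReal (mismatch (yhat ω.2) ω.1.1) ∂(csbm n d α β R)

/-- `I*(a, b, c) = ((√a - √b)² + c) / 2`. -/
def IStar (a b c : ℝ) : ℝ := ((√a - √b) ^ 2 + c) / 2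

end CSBM

end

/-! The misclassification rate is bounded below by the frequency of pairs (i, j) for which the
estimator misjudges the product y_i y_j, a quantity insensitive to the global sign
(`sum_pairs_ne_le_mismatch`). For a fixed pair, flipping the label i exchanges right and wrong
answers, so under the uniform prior on labels the error is that of testing y against `flipAt i y`,
all other labels being known. With A fixed, the estimator is a test based on the attributes. Hence
the total error is at least the overlap of the two network likelihoods, averaged over y, times a
lower bound on the attribute error that is uniform over tests (`csbm_pair_error_ge`). The two
exponents add up to I* q.

Attributes (`attribute_test_le`): given the other attributes, the density in μ depends only on ‖μ‖
and on the inner product of μ with their signed sum w. Reflection in the line of w preserves this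
density and the uniform law on the sphere. Under the flipped label, the reflected μ yields a mean
for x_i that differs from the original one only by twice the projection u of μ on w. What remains is
a test between N(v + u, I) and N(v - u, I) with u orthogonal to v, whose error is at least
exp(-‖u‖²/2 - ‖u‖) by Jensen. Moment bounds show that ‖u‖² has mean at most cq + O(√q).

Network (`network_overlap_le`): only edges at i matter. The minimum of the two likelihoods is their
geometric mean times exp(-|S|/2), where S is the log-likelihood ratio. The geometric mean is
compared with the product of Bernoulli laws of parameter √(αβ), at cost about (√a - √b)² q/2.
Averaged over y, the label products in S are orthogonal, so S² has mean O(q) and the factor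
exp(-|S|/2) costs only O(√q), again by Jensen. No change of measure beyond this one and no
concentration inequality is needed.

All losses are exp(-O(√q)), explicit in `risk_ge_exp`, and vanish after division by q. -/

namespace MeasureTheory.Measure

/-! ### Densities of product measures -/

theorem lintegral_pi_prod {ι : Type*} [Fintype ι] {X : ι → Type*} [∀ i, MeasurableSpace (X i)]
    (μ : ∀ i, Measure (X i)) [∀ i, IsProbabilityMeasure (μ i)] {f : ∀ i, X i → ENNReal}
    (hf : ∀ i, Measurable (f i)) :
    ∫⁻ x, ∏ i, f i (x i) ∂(Measure.pi μ) = ∏ i, ∫⁻ x, f i x ∂(μ i) := by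
  have h := lintegral_prod_eq_prod_lintegral_of_indepFun (μ := Measure.pi μ) Finset.univ
    (fun i x => f i (x i)) (iIndepFun_pi fun i => (hf i).aemeasurable)
    (fun i => (hf i).comp (measurable_pi_apply i))
  rw [h]
  refine Finset.prod_congr rfl fun i _ => ?_
  rw [← (measurePreserving_eval μ i).lintegral_comp (hf i)]

theorem pi_withDensity {ι : Type*} [Fintype ι] {X : ι → Type*} [∀ i, MeasurableSpace (X i)]
    (μ : ∀ i, Measure (X i)) [∀ i, IsProbabilityMeasure (μ i)] {f : ∀ i, X i → ENNReal}
    (hf : ∀ i, Measurable (f i)) [∀ i, SigmaFinite ((μ i).withDensity (f i))] :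
    Measure.pi (fun i => (μ i).withDensity (f i)) =
      (Measure.pi μ).withDensity (fun x => ∏ i, f i (x i)) := by
  refine Measure.pi_eq fun s hs => ?_
  rw [withDensity_apply _ (.univ_pi hs), ← lintegral_indicator (.univ_pi hs)]
  have : ∀ x : ∀ i, X i, (Set.univ.pi s).indicator (fun x => ∏ i, f i (x i)) x =
      ∏ i, (s i).indicator (f i) (x i) := by
    intro x
    by_cases hx : x ∈ Set.univ.pi s
    · rw [Set.indicator_of_mem hx]
      exact Finset.prod_congr rfl fun i _ =>
        (Set.indicator_of_mem (hx i (Set.mem_univ i)) _).symm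
    · rw [Set.indicator_of_notMem hx]
      simp only [Set.mem_pi, Set.mem_univ, true_imp_iff, not_forall] at hx
      obtain ⟨i, hi⟩ := hx
      exact (Finset.prod_eq_zero (Finset.mem_univ i) (Set.indicator_of_notMem hi _)).symm
  simp_rw [this]
  rw [lintegral_pi_prod μ fun i => (hf i).indicator (hs i)]
  refine Finset.prod_congr rfl fun i _ => ?_
  rw [lintegral_indicator (hs i), withDensity_apply _ (hs i)]

/-- Translates of product measures with a density have the product density. -/
theorem pi_map_add_eq_withDensity {ι : Type*} [Fintype ι] {E : Type*} [MeasurableSpace E]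
    [AddCommGroup E] [MeasurableAdd E]
    (μ : Measure E) [IsProbabilityMeasure μ] {f : ι → E → ENNReal}
    (hf : ∀ i, Measurable (f i)) (h : ι → E)
    (hμ : ∀ i, μ.map (· + h i) = μ.withDensity (f i)) :
    (Measure.pi fun _ : ι => μ).map (· + h) =
      (Measure.pi fun _ : ι => μ).withDensity (fun x => ∏ i, f i (x i)) := by
  have hp : ∀ i, IsProbabilityMeasure (μ.map (· + h i)) := fun i =>
    Measure.isProbabilityMeasure_map (by fun_prop)
  have : ∀ i, SigmaFinite (μ.withDensity (f i)) := fun i => by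
    rw [← hμ i]; infer_instance
  rw [← pi_withDensity (fun _ => μ) hf]
  simp_rw [← hμ]
  exact Measure.pi_map_pi (f := fun i x => x + h i) (μ := fun _ => μ)
    (fun i => by fun_prop)

end MeasureTheory.Measure

/-! ### Cameron–Martin formulas for standard Gaussian vectors -/

namespace ProbabilityTheory

theorem gaussianReal_map_add_eq_withDensity (h : ℝ) :
    (gaussianReal 0 1).map (· + h) =
      (gaussianReal 0 1).withDensity (fun x => ENNReal.ofReal (Real.exp (h * x - h ^ 2 / 2))) := by
  rw [gaussianReal_map_add_const, gaussianReal_of_var_ne_zero _ one_ne_zero,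
    gaussianReal_of_var_ne_zero _ one_ne_zero,
    ← withDensity_mul _ (by fun_prop) (by fun_prop)]
  congr 1
  ext x
  simp only [gaussianPDF, Pi.mul_apply]
  rw [← ENNReal.ofReal_mul (gaussianPDFReal_nonneg _ _ _)]
  congr 1
  simp only [gaussianPDFReal, NNReal.coe_one, mul_one]
  rw [mul_assoc, ← Real.exp_add]
  congr 2
  ring

theorem stdGaussian_map_add_eq_withDensity {d : ℕ} (h : EuclideanSpace ℝ (Fin d)) :
    (stdGaussian (EuclideanSpace ℝ (Fin d))).map (· + h) =
      (stdGaussian (EuclideanSpace ℝ (Fin d))).withDensity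
        (fun x => ENNReal.ofReal (Real.exp (inner ℝ h x - ‖h‖ ^ 2 / 2))) := by
  have key := Measure.pi_map_add_eq_withDensity (gaussianReal 0 1)
    (f := fun (i : Fin d) x => ENNReal.ofReal (Real.exp (h i * x - h i ^ 2 / 2)))
    (fun i => by fun_prop) (fun i => h i) (fun i => gaussianReal_map_add_eq_withDensity (h i))
  have hm : Measurable (WithLp.toLp 2 : (Fin d → ℝ) → EuclideanSpace ℝ (Fin d)) := by fun_prop
  have hL := congrArg (Measure.map (WithLp.toLp 2 : (Fin d → ℝ) → EuclideanSpace ℝ (Fin d))) key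
  rw [← map_pi_eq_stdGaussian]
  rw [Measure.map_map hm (by fun_prop)] at hL
  rw [Measure.map_map (by fun_prop) hm]
  have e1 : (fun x : EuclideanSpace ℝ (Fin d) => x + h) ∘ WithLp.toLp 2 =
      (WithLp.toLp 2) ∘ (fun x : Fin d → ℝ => x + fun i => h i) := by
    ext x i; simp
  rw [e1, hL]
  ext s hs
  rw [Measure.map_apply hm hs, withDensity_apply _ (hm hs), withDensity_apply _ hs,
    setLIntegral_map hs (by fun_prop) hm]
  refine lintegral_congr fun x => ?_
  rw [← ENNReal.ofReal_prod_of_nonneg (fun i _ => (Real.exp_pos _).le), ← Real.exp_sum]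
  congr 2
  rw [Finset.sum_sub_distrib, EuclideanSpace.norm_sq_eq, Finset.sum_div]
  simp [PiLp.inner_apply, mul_comm]

/-- The Cameron–Martin formula for a product of standard Gaussian measures. -/
theorem lintegral_pi_stdGaussian_add {ι : Type*} [Fintype ι] {d : ℕ}
    (h : ι → EuclideanSpace ℝ (Fin d)) {F : (ι → EuclideanSpace ℝ (Fin d)) → ENNReal}
    (hF : Measurable F) :
    ∫⁻ z, F (z + h) ∂(Measure.pi fun _ : ι => stdGaussian (EuclideanSpace ℝ (Fin d))) =
      ∫⁻ z, ENNReal.ofReal (Real.exp (∑ j, inner ℝ (h j) (z j) - (∑ j, ‖h j‖ ^ 2) / 2)) * F z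
        ∂(Measure.pi fun _ : ι => stdGaussian (EuclideanSpace ℝ (Fin d))) := by
  have key := Measure.pi_map_add_eq_withDensity (stdGaussian (EuclideanSpace ℝ (Fin d)))
    (f := fun (i : ι) x => ENNReal.ofReal (Real.exp (inner ℝ (h i) x - ‖h i‖ ^ 2 / 2)))
    (fun i => by fun_prop) h (fun i => stdGaussian_map_add_eq_withDensity (h i))
  rw [← lintegral_map hF (by fun_prop), key, lintegral_withDensity_eq_lintegral_mul _
    (by fun_prop) hF]
  refine lintegral_congr fun z => ?_
  simp only [Pi.mul_apply]
  rw [← ENNReal.ofReal_prod_of_nonneg (fun i _ => (Real.exp_pos _).le), ← Real.exp_sum,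
    Finset.sum_sub_distrib, Finset.sum_div]

theorem lintegral_stdGaussian_add {d : ℕ}
    (h : EuclideanSpace ℝ (Fin d)) {F : EuclideanSpace ℝ (Fin d) → ENNReal}
    (hF : Measurable F) :
    ∫⁻ z, F (z + h) ∂(stdGaussian (EuclideanSpace ℝ (Fin d))) =
      ∫⁻ z, ENNReal.ofReal (Real.exp (inner ℝ h z - ‖h‖ ^ 2 / 2)) * F z
        ∂(stdGaussian (EuclideanSpace ℝ (Fin d))) := by
  rw [← lintegral_map hF (by fun_prop), stdGaussian_map_add_eq_withDensity,
    lintegral_withDensity_eq_lintegral_mul _ (by fun_prop) hF]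
  rfl

end ProbabilityTheory

/-! ### Rotation invariance of the uniform law on the sphere -/

namespace CSBM

open Pointwise in
-- The surface measure of a set is, up to a constant factor, the volume of the cone over it. A
-- linear isometry maps cones to cones and preserves volume.
theorem toSphere_map_isometry {d : ℕ}
    (L : EuclideanSpace ℝ (Fin d) ≃ₗᵢ[ℝ] EuclideanSpace ℝ (Fin d))
    {s : Set (EuclideanSpace ℝ (Fin d))} (hs : MeasurableSet s) :
    (volume : Measure (EuclideanSpace ℝ (Fin d))).toSphere (Subtype.val ⁻¹' (L ⁻¹' s)) =
      (volume : Measure (EuclideanSpace ℝ (Fin d))).toSphere (Subtype.val ⁻¹' s) := by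
  have hc : Measurable (Subtype.val :
    Metric.sphere (0 : EuclideanSpace ℝ (Fin d)) 1 → EuclideanSpace ℝ (Fin d)) :=
    measurable_subtype_coe
  rw [Measure.toSphere_apply' _ (hc (L.continuous.measurable hs)),
    Measure.toSphere_apply' _ (hc hs)]
  congr 1
  refine Eq.trans ?_ (L.measurePreserving.measure_preimage_equiv (f := L.toMeasurableEquiv)
    (Set.Ioo (0 : ℝ) 1 • (Subtype.val '' (Subtype.val ⁻¹' s))))
  congr 1
  ext x
  simp only [Set.mem_smul, Set.mem_image, Set.mem_preimage]
  constructor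
  · rintro ⟨t, ht, _, ⟨u, hu, rfl⟩, rfl⟩
    refine ⟨t, ht, L u, ⟨⟨L u, by simp⟩, hu, rfl⟩, ?_⟩
    simp
  · rintro ⟨t, ht, _, ⟨u, hu, rfl⟩, h⟩
    refine ⟨t, ht, L.symm u, ⟨⟨L.symm u, by simp⟩, by simpa using hu, rfl⟩, ?_⟩
    apply L.injective
    simpa using h

theorem spherePrior_map_isometry (d : ℕ) (R : ℝ)
    (L : EuclideanSpace ℝ (Fin d) ≃ₗᵢ[ℝ] EuclideanSpace ℝ (Fin d)) :
    (spherePrior d R).map L = spherePrior d R := by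
  have hL : Measurable L := L.continuous.measurable
  have hm : Measurable (fun u : Metric.sphere (0 : EuclideanSpace ℝ (Fin d)) 1 =>
    R • (u : EuclideanSpace ℝ (Fin d))) := by fun_prop
  ext s hs
  simp only [spherePrior]
  rw [Measure.map_apply hL hs, Measure.map_apply hm (hL hs), Measure.map_apply hm hs,
    Measure.smul_apply, Measure.smul_apply]
  congr 1
  have := toSphere_map_isometry L (s := (fun x => R • x) ⁻¹' s) ((measurable_const_smul R) hs)
  refine Eq.trans (congrArg _ ?_) this
  ext u
  simp

theorem isProbabilityMeasure_spherePrior {d : ℕ} (hd : 1 ≤ d) (R : ℝ) :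
    IsProbabilityMeasure (spherePrior d R) := by
  have : Nonempty (Fin d) := ⟨⟨0, hd⟩⟩
  have hne : (volume : Measure (EuclideanSpace ℝ (Fin d))).toSphere Set.univ ≠ 0 := by
    rw [Ne, Measure.measure_univ_eq_zero]
    exact Measure.toSphere_ne_zero _
  have : IsProbabilityMeasure
      (((volume : Measure (EuclideanSpace ℝ (Fin d))).toSphere Set.univ)⁻¹ •
        (volume : Measure (EuclideanSpace ℝ (Fin d))).toSphere) :=
    ⟨by simpa using ENNReal.inv_mul_cancel hne (measure_ne_top _ _)⟩
  exact Measure.isProbabilityMeasure_map (by fun_prop)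

theorem norm_eq_of_spherePrior (d : ℕ) {R : ℝ} (hR : 0 ≤ R) :
    ∀ᵐ u ∂(spherePrior d R), ‖u‖ = R := by
  simp only [spherePrior]
  rw [ae_map_iff (by fun_prop) (by measurability)]
  refine Filter.Eventually.of_forall fun u => ?_
  simp [norm_smul, abs_of_nonneg hR]

end CSBM

/-! ### Jensen's inequality and resampling of one coordinate -/

namespace MeasureTheory

/-- Jensen's inequality for the exponential, in extended nonnegative form. -/
theorem ofReal_exp_integral_le_lintegral {α : Type*} [MeasurableSpace α] {μ : Measure α}
    [IsProbabilityMeasure μ] {f : α → ℝ} (hf : Integrable f μ) :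
    ENNReal.ofReal (Real.exp (∫ x, f x ∂μ)) ≤ ∫⁻ x, ENNReal.ofReal (Real.exp (f x)) ∂μ := by
  by_cases hi : Integrable (fun x => Real.exp (f x)) μ
  · rw [← ofReal_integral_eq_lintegral_ofReal hi (.of_forall fun x => (Real.exp_pos _).le)]
    exact ENNReal.ofReal_le_ofReal (convexOn_exp.map_integral_le Real.continuous_exp.continuousOn
      isClosed_univ (.of_forall fun _ => Set.mem_univ _) hf hi)
  · have : ∫⁻ x, ENNReal.ofReal (Real.exp (f x)) ∂μ = ⊤ := by
      by_contra h
      exact hi ((lintegral_ofReal_ne_top_iff_integrable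
        (Real.continuous_exp.comp_aestronglyMeasurable hf.1)
        (.of_forall fun x => (Real.exp_pos _).le)).1 h)
    rw [this]
    exact le_top

/-- The variance of |f| is nonnegative. -/
theorem integral_abs_le_of_integral_sq_le {α : Type*} [MeasurableSpace α] {μ : Measure α}
    [IsProbabilityMeasure μ] {f : α → ℝ} (hf : MemLp f 2 μ) {s : ℝ} (hs : 0 ≤ s)
    (h : ∫ x, f x ^ 2 ∂μ ≤ s ^ 2) : ∫ x, |f x| ∂μ ≤ s := by
  have h1 := variance_nonneg (fun x => |f x|) μ
  have h0 : Var[fun x => |f x|; μ] = _ := variance_eq_sub hf.abs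
  rw [h0] at h1
  have h2 : ∫ x, ((fun x => |f x|) ^ 2) x ∂μ = ∫ x, f x ^ 2 ∂μ := by simp
  rw [h2] at h1
  exact abs_le_of_sq_le_sq' (by linarith) hs |>.2

/-- Resampling one coordinate does not change a product of probability measures. -/
theorem lintegral_pi_update {ι : Type*} [Fintype ι] [DecidableEq ι] {X : ι → Type*}
    [∀ i, MeasurableSpace (X i)] (μ : ∀ i, Measure (X i)) [∀ i, IsProbabilityMeasure (μ i)]
    {F : (∀ i, X i) → ENNReal} (hF : Measurable F) (i : ι) :
    ∫⁻ x, F x ∂(Measure.pi μ) =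
      ∫⁻ x, ∫⁻ t, F (Function.update x i t) ∂(μ i) ∂(Measure.pi μ) := by
  rcases isEmpty_or_nonempty (∀ i, X i) with he | ⟨⟨x₀⟩⟩
  · simp
  simp_rw [← lmarginal_singleton (μ := μ) F i]
  refine lintegral_eq_of_lmarginal_eq {i} hF (hF.lmarginal μ) ?_
  ext x
  have : ∀ z t, (∫⋯∫⁻_{i}, F ∂μ) (Function.update z i t) = (∫⋯∫⁻_{i}, F ∂μ) z := fun z t =>
    lmarginal_update_of_mem μ (Finset.mem_singleton_self i) _ _ _
  rw [lmarginal_singleton (μ := μ) (∫⋯∫⁻_{i}, F ∂μ) i]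
  simp [this]

end MeasureTheory

/-! ### Testing between two Gaussian vectors -/

namespace ProbabilityTheory

variable {d : ℕ}

local notation "𝔼" => EuclideanSpace ℝ (Fin d)

theorem memLp_inner_stdGaussian (u : 𝔼) : MemLp (fun t => inner ℝ u t) 2 (stdGaussian 𝔼) :=
  IsGaussian.memLp_dual (stdGaussian 𝔼) (innerSL ℝ u) 2 (by simp)

theorem integral_inner_stdGaussian (u : 𝔼) : ∫ t, inner ℝ u t ∂(stdGaussian 𝔼) = 0 :=
  integral_strongDual_stdGaussian (innerSL ℝ u)

theorem integral_inner_sq_stdGaussian (u : 𝔼) :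
    ∫ t, (inner ℝ u t : ℝ) ^ 2 ∂(stdGaussian 𝔼) = ‖u‖ ^ 2 := by
  have h := variance_dual_stdGaussian (innerSL ℝ u)
  have h1 : Var[innerSL ℝ u; stdGaussian 𝔼] = _ := variance_eq_sub (memLp_inner_stdGaussian u)
  have h2 : ∫ t, innerSL ℝ u t ∂(stdGaussian 𝔼) = 0 := integral_inner_stdGaussian u
  rw [innerSL_apply_norm, h1, h2] at h
  simpa using h

theorem integral_abs_inner_stdGaussian_le (u : 𝔼) :
    ∫ t, |(inner ℝ u t : ℝ)| ∂(stdGaussian 𝔼) ≤ ‖u‖ :=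
  integral_abs_le_of_integral_sq_le (memLp_inner_stdGaussian u) (norm_nonneg _)
    (integral_inner_sq_stdGaussian u).le

/-- Lower bound on the total error of a test between `N(v + u, I)` and `N(v - u, I)`. -/
theorem two_point_test_le {u v : 𝔼} (huv : (inner ℝ u v : ℝ) = 0) {C : Set 𝔼}
    (hC : MeasurableSet C) :
    ENNReal.ofReal (Real.exp (-(‖u‖ ^ 2 / 2 + ‖u‖))) ≤
      ∫⁻ t, ENNReal.ofReal (Real.exp (inner ℝ (v + u) t - ‖v + u‖ ^ 2 / 2)) *
          C.indicator 1 t ∂(stdGaussian 𝔼) +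
        ∫⁻ t, ENNReal.ofReal (Real.exp (inner ℝ (v - u) t - ‖v - u‖ ^ 2 / 2)) *
          Cᶜ.indicator 1 t ∂(stdGaussian 𝔼) := by
  -- Since u is orthogonal to v, the density of N(v + u, I) is the product of those of N(v, I) and
  -- N(u, I). Translation by v absorbs the first factor, and v survives only in the test set.
  have h1 : ∀ D : Set 𝔼, MeasurableSet D → ∀ u : 𝔼, (inner ℝ u v : ℝ) = 0 →
      ∫⁻ t, ENNReal.ofReal (Real.exp (inner ℝ (v + u) t - ‖v + u‖ ^ 2 / 2)) *
          D.indicator 1 t ∂(stdGaussian 𝔼) =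
      ∫⁻ t, ENNReal.ofReal (Real.exp (inner ℝ u t - ‖u‖ ^ 2 / 2)) *
          D.indicator 1 (t + v) ∂(stdGaussian 𝔼) := by
    intro D hD u hu
    have hm : Measurable (D.indicator (1 : 𝔼 → ENNReal)) := measurable_one.indicator hD
    have := lintegral_stdGaussian_add v
      (F := fun t => ENNReal.ofReal (Real.exp (inner ℝ u t - ‖u‖ ^ 2 / 2)) * D.indicator 1 t)
      (by fun_prop)
    simp only [inner_add_right, hu, add_zero] at this
    rw [this]
    refine lintegral_congr fun t => ?_
    rw [← mul_assoc, ← ENNReal.ofReal_mul (Real.exp_pos _).le, ← Real.exp_add]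
    congr 3
    rw [norm_add_sq_real, inner_add_left, real_inner_comm u v, hu]
    ring
  have h2 := h1 C hC u huv
  have h3 := h1 Cᶜ hC.compl (-u) (by simp [huv])
  rw [← sub_eq_add_neg] at h3
  have hm : Measurable (C.indicator (1 : 𝔼 → ENNReal)) := measurable_one.indicator hC
  rw [h2, h3, ← lintegral_add_left (by fun_prop)]
  have hint : Integrable (fun t => -(‖u‖ ^ 2 / 2 + |(inner ℝ u t : ℝ)|)) (stdGaussian 𝔼) :=
    ((integrable_const _).add ((memLp_inner_stdGaussian u).integrable (by simp)).abs).neg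
  calc _ ≤ ENNReal.ofReal (Real.exp (∫ t, -(‖u‖ ^ 2 / 2 + |(inner ℝ u t : ℝ)|)
          ∂(stdGaussian 𝔼))) := by
        refine ENNReal.ofReal_le_ofReal (Real.exp_le_exp.2 ?_)
        rw [integral_neg, integral_add (integrable_const _)
          ((memLp_inner_stdGaussian u).integrable (by simp)).abs]
        have := integral_abs_inner_stdGaussian_le u
        simp only [integral_const, probReal_univ, one_smul]
        linarith
    _ ≤ _ := ofReal_exp_integral_le_lintegral hint
    _ ≤ _ := by
        refine lintegral_mono fun t => ?_
        simp only
        -- Exactly one indicator is nonzero, and either exponent is at least -(‖u‖²/2 + |⟨u, t⟩|).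
        -- This bound no longer depends on the test.
        by_cases ht : t + v ∈ C
        · rw [Set.indicator_of_mem ht, Set.indicator_of_notMem (by simpa using ht)]
          simp only [Pi.one_apply, mul_one, mul_zero, add_zero]
          exact ENNReal.ofReal_le_ofReal (Real.exp_le_exp.2
            (by linarith [neg_abs_le (inner ℝ u t : ℝ)]))
        · rw [Set.indicator_of_notMem ht, Set.indicator_of_mem (by simpa using ht)]
          simp only [Pi.one_apply, mul_one, mul_zero, zero_add, inner_neg_left, norm_neg]
          exact ENNReal.ofReal_le_ofReal (Real.exp_le_exp.2
            (by linarith [le_abs_self (inner ℝ u t : ℝ)]))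

end ProbabilityTheory

/-! ### Testing one label from the attributes -/

namespace CSBM

variable {n d : ℕ}

local notation "𝔼" => EuclideanSpace ℝ (Fin d)

/-- The label vector with the sign of the `i`-th label flipped. -/
def flipAt (i : Fin n) (y : Labels n) : Labels n := Function.update y i (-(y i))

theorem flipAt_same (i : Fin n) (y : Labels n) : flipAt i y i = -y i := by simp [flipAt]

theorem flipAt_of_ne {i j : Fin n} (h : j ≠ i) (y : Labels n) : flipAt i y j = y j := by
  simp [flipAt, h]

theorem flipAt_involutive (i : Fin n) : Function.Involutive (flipAt i) := fun y => by
  simp [flipAt]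

/-- A label as a real number. -/
noncomputable def sgn (s : ℤˣ) : ℝ := ((s : ℤ) : ℝ)

theorem sgn_mul_self (s : ℤˣ) : sgn s * sgn s = 1 := by
  rcases Int.units_eq_one_or s with rfl | rfl <;> simp [sgn]

theorem sgn_neg (s : ℤˣ) : sgn (-s) = -sgn s := by simp [sgn]

theorem abs_sgn (s : ℤˣ) : |sgn s| = 1 := by
  rcases Int.units_eq_one_or s with rfl | rfl <;> simp [sgn]

/-- The signed sum of all attributes but the `i`-th. -/
noncomputable def signedSum (i : Fin n) (y : Labels n) (x : Attr n d) : 𝔼 :=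
  ∑ j ∈ Finset.univ.erase i, sgn (y j) • x j

/-- The length of the projection of `u` on the line spanned by `w`. -/
noncomputable def projLength (w u : 𝔼) : ℝ := |inner ℝ w u| / ‖w‖

theorem measurable_signedSum (i : Fin n) (y : Labels n) :
    Measurable (signedSum (d := d) i y) := by unfold signedSum; fun_prop

theorem measurable_projLength :
    Measurable (fun p : 𝔼 × 𝔼 => projLength p.1 p.2) := by
  unfold projLength; fun_prop

theorem measurable_exp_projLength :
    Measurable fun p : 𝔼 × 𝔼 => ENNReal.ofReal (Real.exp
      (-(projLength p.1 p.2 ^ 2 / 2 + projLength p.1 p.2))) := by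
  have h : Measurable fun r : ℝ => ENNReal.ofReal (Real.exp (-(r ^ 2 / 2 + r))) := by fun_prop
  exact h.comp measurable_projLength

theorem signedSum_flipAt (i : Fin n) (y : Labels n) (x : Attr n d) :
    signedSum i (flipAt i y) x = signedSum i y x :=
  Finset.sum_congr rfl fun j hj => by rw [flipAt_of_ne (Finset.ne_of_mem_erase hj)]

theorem signedSum_update (i : Fin n) (y : Labels n) (x : Attr n d) (t : 𝔼) :
    signedSum i y (Function.update x i t) = signedSum i y x :=
  Finset.sum_congr rfl fun j hj => by
    rw [Function.update_of_ne (Finset.ne_of_mem_erase hj)]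

/-- The density relative to pure noise shows that the signed sum of the attributes is a sufficient
statistic for μ when the labels are known. -/
theorem gmm_apply (μ : 𝔼) (y : Labels n) {C : Set (Attr n d)} (hC : MeasurableSet C) :
    gmm μ y C = ∫⁻ z, ENNReal.ofReal (Real.exp (inner ℝ (∑ j, sgn (y j) • z j) μ
        - n * ‖μ‖ ^ 2 / 2)) * C.indicator 1 z
      ∂(Measure.pi fun _ : Fin n => stdGaussian 𝔼) := by
  have hs : Measurable (shift (n := n) μ y) := (measurable_shift y).comp measurable_prodMk_left
  have hm : Measurable (C.indicator (1 : Attr n d → ENNReal)) := measurable_one.indicator hC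
  rw [gmm, ← lintegral_indicator_one hC, lintegral_map hm hs]
  have := lintegral_pi_stdGaussian_add (fun j => sgn (y j) • μ) hm
  refine Eq.trans (lintegral_congr fun z => ?_) (this.trans (lintegral_congr fun z => ?_))
  · congr 1
    ext1 j
    simp [shift, sgn, add_comm]
  · congr 4
    · simp [sum_inner, inner_smul_left, real_inner_comm]
    · simp [norm_smul, abs_sgn]

/-- The Gaussian density factor of all attributes but the `i`-th. -/
noncomputable def leaveOneDensity (i : Fin n) (y : Labels n) (μ : 𝔼) (x : Attr n d) : ENNReal :=
  ENNReal.ofReal (Real.exp (inner ℝ (signedSum i y x) μ - (n - 1 : ℕ) * ‖μ‖ ^ 2 / 2))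

theorem measurable_leaveOneDensity (i : Fin n) (y : Labels n) :
    Measurable (fun p : 𝔼 × Attr n d => leaveOneDensity i y p.1 p.2) := by
  have := measurable_signedSum (d := d) i y
  unfold leaveOneDensity
  fun_prop

/-- The density factors into the part of x_i and that of the other attributes. Resampling x_i
isolates the only attribute whose law is affected by flipping the label i. -/
theorem gmm_apply_resample (i : Fin n) (μ : 𝔼) (y : Labels n) {C : Set (Attr n d)}
    (hC : MeasurableSet C) :
    gmm μ y C = ∫⁻ x, leaveOneDensity i y μ x *
        ∫⁻ t, ENNReal.ofReal (Real.exp (inner ℝ (sgn (y i) • μ) t - ‖sgn (y i) • μ‖ ^ 2 / 2)) *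
          {t | Function.update x i t ∈ C}.indicator 1 t ∂(stdGaussian 𝔼)
      ∂(Measure.pi fun _ : Fin n => stdGaussian 𝔼) := by
  have hm : Measurable (C.indicator (1 : Attr n d → ENNReal)) := measurable_one.indicator hC
  rw [gmm_apply μ y hC, lintegral_pi_update _ (by fun_prop) i]
  refine lintegral_congr fun x => ?_
  have hD : MeasurableSet {t | Function.update x i t ∈ C} := measurable_update x hC
  have hm' : Measurable ({t | Function.update x i t ∈ C}.indicator (1 : 𝔼 → ENNReal)) :=
    measurable_one.indicator hD
  rw [← lintegral_const_mul _ (by fun_prop)]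
  refine lintegral_congr fun t => ?_
  rw [← mul_assoc, leaveOneDensity, ← ENNReal.ofReal_mul (Real.exp_pos _).le, ← Real.exp_add]
  have hind : C.indicator (1 : Attr n d → ENNReal) (Function.update x i t) =
      {t | Function.update x i t ∈ C}.indicator (1 : 𝔼 → ENNReal) t := rfl
  rw [hind]
  congr 3
  rw [← Finset.add_sum_erase _ _ (Finset.mem_univ i), Function.update_self, inner_add_left]
  have h1 : ∑ j ∈ Finset.univ.erase i, sgn (y j) • Function.update x i t j = signedSum i y x :=
    signedSum_update i y x t
  rw [h1, inner_smul_left, inner_smul_left, norm_smul, Real.norm_eq_abs, abs_sgn,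
    real_inner_comm, Nat.cast_pred i.pos]
  simp only [conj_trivial]
  ring

/-- Cameron–Martin read backwards, with no shift at i: each of the n - 1 other attributes adds sgn²
μ = μ to the signed sum. -/
theorem lintegral_leaveOneDensity_mul (i : Fin n) (y : Labels n) (μ : 𝔼)
    {F : 𝔼 → ENNReal} (hF : Measurable F) :
    ∫⁻ x, leaveOneDensity i y μ x * F (signedSum i y x)
        ∂(Measure.pi fun _ : Fin n => stdGaussian 𝔼) =
      ∫⁻ z, F (((n - 1 : ℕ) : ℝ) • μ + signedSum i y z)
        ∂(Measure.pi fun _ : Fin n => stdGaussian 𝔼) := by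
  have := lintegral_pi_stdGaussian_add (fun j => if j = i then 0 else sgn (y j) • μ)
    (hF.comp (measurable_signedSum i y))
  have hc : (Finset.univ.erase i).card = n - 1 := by simp
  refine Eq.trans (lintegral_congr fun z => ?_)
    (this.symm.trans (lintegral_congr fun z => ?_))
  · rw [leaveOneDensity]
    congr 4
    · rw [← Finset.add_sum_erase _ _ (Finset.mem_univ i), if_pos rfl, inner_zero_left, zero_add,
        signedSum, sum_inner]
      refine Finset.sum_congr rfl fun j hj => ?_
      rw [if_neg (Finset.ne_of_mem_erase hj), inner_smul_left, inner_smul_left, real_inner_comm]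
    · congr 1
      rw [← Finset.add_sum_erase _ _ (Finset.mem_univ i), if_pos rfl, norm_zero,
        Finset.sum_congr rfl (g := fun _ => ‖μ‖ ^ 2), Finset.sum_const, hc]
      · simp
      · intro j hj
        rw [if_neg (Finset.ne_of_mem_erase hj), norm_smul, Real.norm_eq_abs, abs_sgn, one_mul]
  · simp only [Function.comp]
    congr 1
    rw [signedSum, ← hc, Nat.cast_smul_eq_nsmul, ← Finset.sum_const, signedSum,
      ← Finset.sum_add_distrib]
    refine Finset.sum_congr rfl fun j hj => ?_
    simp only [Pi.add_apply]
    rw [if_neg (Finset.ne_of_mem_erase hj), smul_add, smul_smul, sgn_mul_self, one_smul, add_comm]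

theorem measurable_gmm_apply (y : Labels n) {C : Set (Attr n d)} (hC : MeasurableSet C) :
    Measurable fun μ : 𝔼 => gmm μ y C := by
  have hm : Measurable (C.indicator (1 : Attr n d → ENNReal)) := measurable_one.indicator hC
  simp_rw [gmm_apply _ y hC]
  have : Measurable fun p : 𝔼 × Attr n d =>
      ENNReal.ofReal (Real.exp (inner ℝ (∑ j, sgn (y j) • p.2 j) p.1
        - n * ‖p.1‖ ^ 2 / 2)) * C.indicator 1 p.2 := by
    fun_prop
  exact this.lintegral_prod_right'

/-- The mass that `N(h, I)` gives to the values of the `i`-th attribute which put `x` in `C`. -/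
noncomputable def coordMass (i : Fin n) (C : Set (Attr n d)) (h : 𝔼) (x : Attr n d) : ENNReal :=
  ∫⁻ t, ENNReal.ofReal (Real.exp (inner ℝ h t - ‖h‖ ^ 2 / 2)) *
    {t | Function.update x i t ∈ C}.indicator 1 t ∂(stdGaussian 𝔼)

theorem measurable_coordMass (i : Fin n) {C : Set (Attr n d)} (hC : MeasurableSet C) :
    Measurable fun p : 𝔼 × Attr n d => coordMass i C p.1 p.2 := by
  have hup : Measurable fun p : (𝔼 × Attr n d) × 𝔼 => Function.update p.1.2 i p.2 :=
    measurable_update'.comp ((measurable_snd.comp measurable_fst).prodMk measurable_snd)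
  have hm : Measurable fun p : (𝔼 × Attr n d) × 𝔼 =>
      C.indicator (1 : Attr n d → ENNReal) (Function.update p.1.2 i p.2) :=
    (measurable_one.indicator hC).comp hup
  have : Measurable fun p : (𝔼 × Attr n d) × 𝔼 =>
      ENNReal.ofReal (Real.exp (inner ℝ p.1.1 p.2 - ‖p.1.1‖ ^ 2 / 2)) *
        C.indicator (1 : Attr n d → ENNReal) (Function.update p.1.2 i p.2) := by
    fun_prop
  exact this.lintegral_prod_right'

theorem measurable_smul_fst (s : ℝ) :
    Measurable fun p : 𝔼 × Attr n d => (s • p.1, p.2) :=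
  ((measurable_const_smul s).comp measurable_fst).prodMk measurable_snd

attribute [irreducible] coordMass leaveOneDensity

theorem measurable_leaveOneDensity_mul_coordMass (i : Fin n) (y : Labels n) (s : ℝ)
    {C : Set (Attr n d)} (hC : MeasurableSet C) :
    Measurable fun p : 𝔼 × Attr n d =>
      leaveOneDensity i y p.1 p.2 * coordMass i C (s • p.1) p.2 := by
  have h2 : Measurable fun p : 𝔼 × Attr n d => coordMass i C (s • p.1) p.2 :=
    have := Measurable.comp (measurable_coordMass (d := d) i hC) (measurable_smul_fst s)
    this
  exact Measurable.mul (measurable_leaveOneDensity i y) h2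

theorem measurable_lintegral_leaveOneDensity_mul_coordMass (σ : Measure 𝔼)
    [IsProbabilityMeasure σ] (i : Fin n) (y : Labels n) (s : ℝ)
    {C : Set (Attr n d)} (hC : MeasurableSet C) :
    Measurable fun x : Attr n d =>
      ∫⁻ μ, leaveOneDensity i y μ x * coordMass i C (s • μ) x ∂σ :=
  (measurable_leaveOneDensity_mul_coordMass i y s hC).lintegral_prod_left'

theorem lintegral_gmm_eq (σ : Measure 𝔼) [IsProbabilityMeasure σ] (i : Fin n) (y : Labels n)
    {C : Set (Attr n d)} (hC : MeasurableSet C) :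
    ∫⁻ μ, gmm μ y C ∂σ =
      ∫⁻ x, ∫⁻ μ, leaveOneDensity i y μ x * coordMass i C (sgn (y i) • μ) x ∂σ
        ∂(Measure.pi fun _ : Fin n => stdGaussian 𝔼) := by
  have hm := (measurable_leaveOneDensity_mul_coordMass i y (sgn (y i)) hC)
  rw [← lintegral_lintegral_swap (f := fun μ x =>
    leaveOneDensity i y μ x * coordMass i C (sgn (y i) • μ) x) hm.aemeasurable]
  refine lintegral_congr fun μ => ?_
  simp only [coordMass]
  exact gmm_apply_resample i μ y hC

theorem leaveOneDensity_flipAt (i : Fin n) (y : Labels n) (μ : 𝔼) (x : Attr n d) :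
    leaveOneDensity i (flipAt i y) μ x = leaveOneDensity i y μ x := by
  rw [leaveOneDensity, signedSum_flipAt, leaveOneDensity]

theorem measurable_signedSum_prodMk (i : Fin n) (y : Labels n) :
    Measurable fun p : 𝔼 × Attr n d => (signedSum i y p.2, p.1) :=
  ((measurable_signedSum i y).comp measurable_snd).prodMk measurable_fst

/-- The reflection fixing the signed sum of the attributes but the `i`-th. -/
noncomputable def signedReflection (i : Fin n) (y : Labels n) (x : Attr n d) : 𝔼 ≃ₗᵢ[ℝ] 𝔼 :=
  (ℝ ∙ signedSum i y x).reflection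

/-- The density depends on μ only through ‖μ‖ and ⟨w, μ⟩ for w the signed sum. The reflection is an
isometry fixing w, so it preserves both. -/
theorem leaveOneDensity_signedReflection (i : Fin n) (y : Labels n) (μ : 𝔼) (x : Attr n d) :
    leaveOneDensity i y (signedReflection i y x μ) x = leaveOneDensity i y μ x := by
  have hw : signedReflection i y x (signedSum i y x) = signedSum i y x :=
    Submodule.reflection_mem_subspace_eq_self (Submodule.mem_span_singleton_self _)
  have h1 : (inner ℝ (signedSum i y x) (signedReflection i y x μ) : ℝ) =
      inner ℝ (signedSum i y x) μ := by
    conv_lhs => rw [← hw]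
    exact LinearIsometryEquiv.inner_map_map _ _ _
  rw [leaveOneDensity, leaveOneDensity, h1, LinearIsometryEquiv.norm_map]

/-- With u the projection of μ on the signed sum, the reflected vector is 2u - μ. The flipped label
turns it, up to the common sign of label i, into μ - 2u = (μ - u) - u, to be told apart from μ = (μ
- u) + u. This is the orthogonal two-point test. -/
theorem coordMass_add_coordMass_signedReflection (i : Fin n) (y : Labels n) (μ : 𝔼)
    (x : Attr n d) {C : Set (Attr n d)} (hC : MeasurableSet C) :
    ENNReal.ofReal (Real.exp (-(projLength (signedSum i y x) μ ^ 2 / 2 +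
        projLength (signedSum i y x) μ))) ≤
      coordMass i C (sgn (y i) • μ) x +
        coordMass i Cᶜ (sgn (flipAt i y i) • signedReflection i y x μ) x := by
  have hLμ : signedReflection i y x μ =
      2 • ((inner ℝ (signedSum i y x) μ : ℝ) / ‖signedSum i y x‖ ^ 2) • signedSum i y x - μ :=
    Submodule.reflection_singleton_apply _ μ
  rw [hLμ]
  generalize signedSum i y x = w
  -- If w = 0, then u and `projLength` both vanish, the latter because division by zero gives zero,
  -- so no case has to be excluded.
  obtain ⟨u, hu⟩ : ∃ u : 𝔼, u = ((inner ℝ w μ : ℝ) / ‖w‖ ^ 2) • w := ⟨_, rfl⟩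
  have horth : (inner ℝ u (μ - u) : ℝ) = 0 := by
    rw [inner_sub_right, hu]
    simp only [inner_smul_left, inner_smul_right, real_inner_self_eq_norm_sq, conj_trivial]
    by_cases hw : ‖w‖ = 0
    · simp [hw]
    · field_simp
      ring
  have hnorm : ‖sgn (y i) • u‖ = projLength w μ := by
    rw [norm_smul, Real.norm_eq_abs, abs_sgn, one_mul, hu, norm_smul, Real.norm_eq_abs,
      abs_div, abs_of_nonneg (sq_nonneg ‖w‖), projLength]
    by_cases hw : ‖w‖ = 0
    · simp [hw]
    · field_simp
  have key := two_point_test_le (u := sgn (y i) • u) (v := sgn (y i) • (μ - u))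
    (by simp [inner_smul_left, inner_smul_right, horth])
    (C := {t | Function.update x i t ∈ C}) (measurable_update x hC)
  have e1 : sgn (y i) • (μ - u) + sgn (y i) • u = sgn (y i) • μ := by
    rw [← smul_add]; simp
  have e2 : sgn (y i) • (μ - u) - sgn (y i) • u = sgn (flipAt i y i) • (2 • u - μ) := by
    rw [flipAt_same, sgn_neg, ← smul_sub, neg_smul, ← smul_neg, two_smul]
    congr 1
    abel
  rw [hnorm, e1, e2] at key
  rw [← hu, coordMass, coordMass]
  exact key

theorem measurable_leaveOneDensity_mul_exp_projLength (i : Fin n) (y : Labels n) :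
    Measurable fun p : 𝔼 × Attr n d => leaveOneDensity i y p.1 p.2 * ENNReal.ofReal (Real.exp
      (-(projLength (signedSum i y p.2) p.1 ^ 2 / 2 + projLength (signedSum i y p.2) p.1))) := by
  have h2 := Measurable.comp (measurable_exp_projLength (d := d))
    (measurable_signedSum_prodMk (d := d) i y)
  exact Measurable.mul (measurable_leaveOneDensity i y) h2

theorem lintegral_exp_projLength_eq (σ : Measure 𝔼) [IsProbabilityMeasure σ] (i : Fin n)
    (y : Labels n) :
    ∫⁻ μ, ∫⁻ z, ENNReal.ofReal (Real.exp
        (-(projLength (((n - 1 : ℕ) : ℝ) • μ + signedSum i y z) μ ^ 2 / 2 +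
          projLength (((n - 1 : ℕ) : ℝ) • μ + signedSum i y z) μ)))
        ∂(Measure.pi fun _ : Fin n => stdGaussian 𝔼) ∂σ =
      ∫⁻ x, ∫⁻ μ, leaveOneDensity i y μ x * ENNReal.ofReal (Real.exp
        (-(projLength (signedSum i y x) μ ^ 2 / 2 + projLength (signedSum i y x) μ)))
        ∂σ ∂(Measure.pi fun _ : Fin n => stdGaussian 𝔼) := by
  rw [← lintegral_lintegral_swap (f := fun μ x => leaveOneDensity i y μ x *
    ENNReal.ofReal (Real.exp (-(projLength (signedSum i y x) μ ^ 2 / 2 +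
      projLength (signedSum i y x) μ))))
    (measurable_leaveOneDensity_mul_exp_projLength i y).aemeasurable]
  refine lintegral_congr fun μ => ?_
  have hF : Measurable fun w : 𝔼 => ENNReal.ofReal (Real.exp
      (-(projLength w μ ^ 2 / 2 + projLength w μ))) := by
    have h := Measurable.comp (measurable_exp_projLength (d := d))
      (measurable_prodMk_right (y := μ))
    exact h
  exact (lintegral_leaveOneDensity_mul i y μ hF).symm

/-- The invariance of σ allows μ to be replaced by its reflection in the second integral only. The
reflection depends on x, hence the argument for x fixed. -/
theorem lintegral_leaveOneDensity_mul_exp_le (σ : Measure 𝔼) [IsProbabilityMeasure σ]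
    (hσ : ∀ L : 𝔼 ≃ₗᵢ[ℝ] 𝔼, σ.map L = σ) (i : Fin n) (y : Labels n) {C : Set (Attr n d)}
    (hC : MeasurableSet C) (x : Attr n d) :
    ∫⁻ μ, leaveOneDensity i y μ x * ENNReal.ofReal (Real.exp
        (-(projLength (signedSum i y x) μ ^ 2 / 2 + projLength (signedSum i y x) μ))) ∂σ ≤
      ∫⁻ μ, leaveOneDensity i y μ x * coordMass i C (sgn (y i) • μ) x ∂σ +
        ∫⁻ μ, leaveOneDensity i y μ x * coordMass i Cᶜ (sgn (flipAt i y i) • μ) x ∂σ := by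
  have hTx : ∀ C, MeasurableSet C → ∀ s : ℝ,
      Measurable fun μ : 𝔼 => leaveOneDensity i y μ x * coordMass i C (s • μ) x :=
    fun C hC s => Measurable.comp (measurable_leaveOneDensity_mul_coordMass i y s hC)
      measurable_prodMk_right
  have hswap : ∫⁻ μ, leaveOneDensity i y μ x *
        coordMass i Cᶜ (sgn (flipAt i y i) • μ) x ∂σ =
      ∫⁻ μ, leaveOneDensity i y (signedReflection i y x μ) x *
        coordMass i Cᶜ (sgn (flipAt i y i) • signedReflection i y x μ) x ∂σ := by
    conv_lhs => rw [← hσ (signedReflection i y x)]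
    exact lintegral_map (hTx Cᶜ hC.compl _)
      (signedReflection i y x).continuous.measurable
  rw [hswap, ← lintegral_add_left (hTx C hC _)]
  refine lintegral_mono fun μ => ?_
  simp only
  rw [leaveOneDensity_signedReflection, ← mul_add]
  exact mul_le_mul_right (coordMass_add_coordMass_signedReflection i y μ x hC) _

/-- Lower bound on the error of testing the sign of one label from the attributes, the other
labels being known. -/
theorem attribute_test_le (σ : Measure 𝔼) [IsProbabilityMeasure σ]
    (hσ : ∀ L : 𝔼 ≃ₗᵢ[ℝ] 𝔼, σ.map L = σ) (i : Fin n) (y : Labels n) {C : Set (Attr n d)}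
    (hC : MeasurableSet C) :
    ∫⁻ μ, ∫⁻ z, ENNReal.ofReal (Real.exp
        (-(projLength (((n - 1 : ℕ) : ℝ) • μ + signedSum i y z) μ ^ 2 / 2 +
          projLength (((n - 1 : ℕ) : ℝ) • μ + signedSum i y z) μ)))
        ∂(Measure.pi fun _ : Fin n => stdGaussian 𝔼) ∂σ ≤
      ∫⁻ μ, gmm μ y C ∂σ + ∫⁻ μ, gmm μ (flipAt i y) Cᶜ ∂σ := by
  rw [lintegral_gmm_eq σ i y hC, lintegral_gmm_eq σ i (flipAt i y) hC.compl,
    lintegral_exp_projLength_eq]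
  simp_rw [leaveOneDensity_flipAt]
  rw [← lintegral_add_left
    (measurable_lintegral_leaveOneDensity_mul_coordMass σ i y (sgn (y i)) hC)]
  exact lintegral_mono fun x => lintegral_leaveOneDensity_mul_exp_le σ hσ i y hC x

end CSBM

/-! ### Moments of Gaussian vectors -/

namespace ProbabilityTheory

variable {d : ℕ}

local notation "𝔼" => EuclideanSpace ℝ (Fin d)

/-- A linear combination of independent standard Gaussian vectors. -/
theorem map_sum_smul_pi_stdGaussian {ι : Type*} [Fintype ι] (c : ι → ℝ) {r : ℝ}
    (hr : r ^ 2 = ∑ j, c j ^ 2) :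
    (Measure.pi fun _ : ι => stdGaussian 𝔼).map (fun z => ∑ j, c j • z j) =
      (stdGaussian 𝔼).map (fun g => r • g) := by
  have : IsProbabilityMeasure ((Measure.pi fun _ : ι => stdGaussian 𝔼).map
    (fun z => ∑ j, c j • z j)) :=
    Measure.isProbabilityMeasure_map (Measurable.aemeasurable (by fun_prop))
  have : IsProbabilityMeasure ((stdGaussian 𝔼).map (fun g => r • g)) :=
    Measure.isProbabilityMeasure_map (by fun_prop)
  refine Measure.ext_of_charFun ?_
  ext t
  have hind : iIndepFun (fun (j : ι) (z : ι → 𝔼) => c j • z j)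
      (Measure.pi fun _ : ι => stdGaussian 𝔼) :=
    iIndepFun_pi (X := fun j (x : 𝔼) => c j • x) (fun j => by fun_prop)
  rw [hind.charFun_map_fun_sum_eq_prod (fun j => Measurable.aemeasurable (by fun_prop)), Finset.prod_apply]
  have h1 : ∀ j, charFun ((Measure.pi fun _ : ι => stdGaussian 𝔼).map (fun z => c j • z j)) t =
      Complex.exp (-‖c j • t‖ ^ 2 / 2) := by
    intro j
    have e : (Measure.pi fun _ : ι => stdGaussian 𝔼).map (fun z => c j • z j) =
        (stdGaussian 𝔼).map (fun x => c j • x) := by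
      conv_rhs => rw [← (measurePreserving_eval (fun _ : ι => stdGaussian 𝔼) j).map_eq]
      rw [Measure.map_map (by fun_prop) (by fun_prop)]
      rfl
    rw [e, charFun_map_smul, charFun_stdGaussian]
  simp_rw [h1]
  rw [charFun_map_smul, charFun_stdGaussian, ← Complex.exp_sum]
  congr 1
  simp only [norm_smul, Real.norm_eq_abs]
  push_cast
  simp only [mul_pow, ← Complex.ofReal_pow, sq_abs]
  rw [hr]
  push_cast
  rw [Finset.sum_mul, ← Finset.sum_neg_distrib, Finset.sum_div]

/-- The crude constant comes from x⁴/4! ≤ exp |x| ≤ exp x + exp(-x), which gives 48 exp(1/2). Any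
absolute constant would do. -/
theorem integral_pow_four_gaussianReal_le : ∫ x, x ^ 4 ∂(gaussianReal 0 1) ≤ 96 := by
  have hi : ∀ t : ℝ, Integrable (fun x => Real.exp (t * x)) (gaussianReal 0 1) :=
    fun t => integrable_exp_mul_gaussianReal t
  have hv : ∀ t : ℝ, ∫ x, Real.exp (t * x) ∂(gaussianReal 0 1) = Real.exp (t ^ 2 / 2) := by
    intro t
    have := congrFun (mgf_fun_id_gaussianReal (μ := 0) (v := 1)) t
    simpa [mgf] using this
  have hb : ∀ x : ℝ, x ^ 4 ≤ 24 * (Real.exp (1 * x) + Real.exp (-1 * x)) := by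
    intro x
    have h := Real.pow_div_factorial_le_exp |x| (abs_nonneg x) 4
    have h4 : |x| ^ 4 = x ^ 4 := by
      rw [show (4 : ℕ) = 2 * 2 from rfl, pow_mul, sq_abs, ← pow_mul]
    rw [h4] at h
    have h2 : Real.exp |x| ≤ Real.exp (1 * x) + Real.exp (-1 * x) := by
      rcases abs_cases x with ⟨h, _⟩ | ⟨h, _⟩ <;> rw [h] <;>
      simp [Real.exp_nonneg]
    have h3 : ((Nat.factorial 4 : ℕ) : ℝ) = 24 := by norm_num [Nat.factorial]
    rw [h3] at h
    linarith
  calc _ ≤ ∫ x, 24 * (Real.exp (1 * x) + Real.exp (-1 * x)) ∂(gaussianReal 0 1) :=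
        integral_mono_of_nonneg (.of_forall fun x => by positivity)
          (((hi 1).add (hi (-1))).const_mul 24) (.of_forall hb)
    _ = 48 * Real.exp (1 / 2) := by
        rw [integral_const_mul, integral_add (hi 1) (hi (-1)), hv, hv]
        norm_num
        ring
    _ ≤ 96 := by
        have : Real.exp (1 / 2) ≤ 2 := by
          rw [← Real.le_log_iff_exp_le two_pos]
          linarith [Real.log_two_gt_d9]
        linarith

theorem memLp_sq_gaussianReal : MemLp (fun x : ℝ => x ^ 2) 2 (gaussianReal 0 1) := by
  have h := memLp_id_gaussianReal (μ := 0) (v := 1) 4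
  refine (memLp_two_iff_integrable_sq (by fun_prop)).2 ?_
  have h4 := h.integrable_norm_pow (p := 4) (by norm_num)
  refine h4.congr (.of_forall fun x => ?_)
  simp only [id, Real.norm_eq_abs]
  rw [show (4 : ℕ) = 2 * 2 from rfl, pow_mul, sq_abs]

/-- The coordinates are independent and x² has variance at most E x⁴ ≤ 100, so ‖g‖² has mean d and
variance at most 100 d. -/
theorem integral_abs_norm_sq_sub_stdGaussian_le :
    ∫ g, |‖g‖ ^ 2 - d| ∂(stdGaussian 𝔼) ≤ 10 * √d := by
  rw [← map_pi_eq_stdGaussian, integral_map (by fun_prop) (by fun_prop)]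
  have hm : ∀ i : Fin d, MemLp (fun x : ℝ => x ^ 2) 2 (gaussianReal 0 1) :=
    fun _ => memLp_sq_gaussianReal
  have hvar := variance_sum_pi (μ := fun _ : Fin d => gaussianReal 0 1)
    (X := fun _ x => x ^ 2) hm
  have hone : Var[fun x : ℝ => x ^ 2; gaussianReal 0 1] ≤ 100 := by
    refine (variance_le_expectation_sq (by fun_prop)).trans ?_
    refine le_trans (le_of_eq ?_) (integral_pow_four_gaussianReal_le.trans (by norm_num))
    refine integral_congr_ae (.of_forall fun x => ?_)
    simp only [Pi.pow_apply]
    ring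
  have hmom : ∫ x, x ^ 2 ∂(gaussianReal 0 1) = 1 := by
    have h := variance_fun_id_gaussianReal (μ := 0) (v := 1)
    rw [variance_of_integral_eq_zero (by fun_prop) (by simp)] at h
    simpa using h
  have hcomp : ∀ i : Fin d, MemLp (fun x : Fin d → ℝ => x i ^ 2) 2
      (Measure.pi fun _ : Fin d => gaussianReal 0 1) := fun i =>
    (hm i).comp_measurePreserving (measurePreserving_eval (fun _ : Fin d => gaussianReal 0 1) i)
  have hsum : MemLp (fun x : Fin d → ℝ => ∑ i, x i ^ 2) 2
      (Measure.pi fun _ : Fin d => gaussianReal 0 1) := memLp_finsetSum _ fun i _ => hcomp i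
  have hmean : ∫ x, ∑ i, x i ^ 2 ∂(Measure.pi fun _ : Fin d => gaussianReal 0 1) = d := by
    rw [integral_finsetSum _ fun i _ => (hcomp i).integrable (by simp)]
    have : ∀ i : Fin d, ∫ x : Fin d → ℝ, x i ^ 2 ∂(Measure.pi fun _ : Fin d => gaussianReal 0 1)
        = 1 := fun i => by
      rw [integral_comp_eval (μ := fun _ : Fin d => gaussianReal 0 1)
        (f := fun x : ℝ => x ^ 2) (by fun_prop), hmom]
    simp [this]
  have hnorm : ∀ x : Fin d → ℝ, ‖(WithLp.toLp 2 x : 𝔼)‖ ^ 2 = ∑ i, x i ^ 2 := fun x => by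
    simp [EuclideanSpace.norm_sq_eq]
  simp_rw [hnorm]
  refine integral_abs_le_of_integral_sq_le (hsum.sub (memLp_const _)) (by positivity) ?_
  have hv2 : Var[fun x : Fin d → ℝ => ∑ i, x i ^ 2;
      Measure.pi fun _ : Fin d => gaussianReal 0 1] ≤ 100 * d := by
    have e : (fun x : Fin d → ℝ => ∑ i, x i ^ 2) = ∑ i, fun x : Fin d → ℝ => x i ^ 2 := by
      ext x; simp
    rw [e, hvar]
    refine (Finset.sum_le_sum fun i _ => hone).trans ?_
    simp [mul_comm]
  rw [variance_eq_integral (Measurable.aemeasurable (by fun_prop)), hmean] at hv2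
  refine hv2.trans (le_of_eq ?_)
  rw [mul_pow, Real.sq_sqrt (Nat.cast_nonneg d)]
  norm_num

end ProbabilityTheory

/-! ### Length of the projection of the mean on the signed sum -/

namespace CSBM

variable {n d : ℕ}

local notation "𝔼" => EuclideanSpace ℝ (Fin d)

theorem projLength_nonneg (w u : 𝔼) : 0 ≤ projLength w u := by
  unfold projLength; positivity

theorem projLength_le_norm (w u : 𝔼) : projLength w u ≤ ‖u‖ := by
  unfold projLength
  refine div_le_of_le_mul₀ (norm_nonneg _) (norm_nonneg _) ?_
  rw [mul_comm]
  exact abs_real_inner_le_norm w u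

theorem projLength_smul {r : ℝ} (hr : r ≠ 0) (w u : 𝔼) :
    projLength (r • w) u = projLength w u := by
  unfold projLength
  rw [inner_smul_left, norm_smul, abs_mul, conj_trivial, Real.norm_eq_abs,
    mul_div_mul_left _ _ (abs_ne_zero.2 hr)]

/-- Replaces the random denominator ‖w‖² by a constant D. The error is controlled by the trivial
bound `projLength` ≤ ‖u‖, so no lower bound on ‖w‖ is needed. -/
theorem projLength_sq_le (w u : 𝔼) {D : ℝ} (hD : 0 < D) :
    projLength w u ^ 2 ≤ (inner ℝ w u : ℝ) ^ 2 / D + ‖u‖ ^ 2 * |‖w‖ ^ 2 - D| / D := by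
  have h1 := projLength_le_norm w u
  have h0 := projLength_nonneg w u
  have h2 : projLength w u ^ 2 ≤ ‖u‖ ^ 2 := pow_le_pow_left₀ h0 h1 2
  have h3 : projLength w u ^ 2 * ‖w‖ ^ 2 ≤ (inner ℝ w u : ℝ) ^ 2 := by
    unfold projLength
    rw [div_pow, sq_abs]
    by_cases hw : ‖w‖ = 0
    · simp [hw, sq_nonneg]
    · rw [div_mul_cancel₀ _ (pow_ne_zero 2 hw)]
  rw [← add_div, le_div_iff₀ hD]
  have h4 : projLength w u ^ 2 * (D - ‖w‖ ^ 2) ≤ ‖u‖ ^ 2 * |‖w‖ ^ 2 - D| := by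
    rw [abs_sub_comm]
    exact (mul_le_mul_of_nonneg_left (le_abs_self _) (sq_nonneg _)).trans
      (mul_le_mul_of_nonneg_right h2 (abs_nonneg _))
  linarith

/-- Take D = R² + τ² d, the mean of ‖μ + τg‖². The leading term is R⁴/D, the variance of ⟨μ, g⟩
contributes at most 1, and the fluctuations of ‖μ + τg‖² contribute 2√s from the cross term and 10√s
from ‖g‖². -/
theorem integral_projLength_sq_le (μ : 𝔼) (hμ : 0 < ‖μ‖) {τ : ℝ} (hτ : 0 ≤ τ) (hτ1 : τ ≤ 1)
    {s : ℝ} (hs : ‖μ‖ ^ 4 / (‖μ‖ ^ 2 + τ ^ 2 * d) ≤ s) :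
    ∫ g, projLength (μ + τ • g) μ ^ 2 ∂(stdGaussian 𝔼) ≤ s + 12 * √s + 1 := by
  set R := ‖μ‖ with hR
  set D := R ^ 2 + τ ^ 2 * d with hD
  have hDR : R ^ 2 ≤ D := by
    have : 0 ≤ τ ^ 2 * (d : ℝ) := by positivity
    linarith
  have hDτ : τ ^ 2 * d ≤ D := by
    have : 0 ≤ R ^ 2 := by positivity
    linarith
  have hDpos : 0 < D := lt_of_lt_of_le (by positivity) hDR
  have hs0 : 0 ≤ s := le_trans (by positivity) hs
  have hL := memLp_inner_stdGaussian μ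
  have hi1 : Integrable (fun g => (inner ℝ μ g : ℝ)) (stdGaussian 𝔼) := hL.integrable (by simp)
  have hi2 : Integrable (fun g => (inner ℝ μ g : ℝ) ^ 2) (stdGaussian 𝔼) := hL.integrable_sq
  have hi3 : Integrable (fun g : 𝔼 => |‖g‖ ^ 2 - d|) (stdGaussian 𝔼) := by
    have : MemLp (id : 𝔼 → 𝔼) 2 (stdGaussian 𝔼) := IsGaussian.memLp_two_id
    exact ((this.integrable_norm_pow (p := 2) (by norm_num)).sub (integrable_const _)).abs
  have hpt : ∀ g : 𝔼, projLength (μ + τ • g) μ ^ 2 ≤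
      (R ^ 4 + 2 * R ^ 2 * τ * inner ℝ μ g + τ ^ 2 * (inner ℝ μ g : ℝ) ^ 2) / D +
        R ^ 2 * (2 * τ * |(inner ℝ μ g : ℝ)| + τ ^ 2 * |‖g‖ ^ 2 - d|) / D := by
    intro g
    refine (projLength_sq_le _ _ hDpos).trans (add_le_add (le_of_eq ?_) ?_)
    · rw [inner_add_left, inner_smul_left, real_inner_self_eq_norm_sq, conj_trivial,
        real_inner_comm]
      ring
    · refine div_le_div_of_nonneg_right (mul_le_mul_of_nonneg_left ?_ (by positivity)) hDpos.le
      rw [norm_add_sq_real, inner_smul_right, norm_smul, mul_pow, Real.norm_eq_abs, sq_abs, hD]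
      calc _ = |2 * τ * inner ℝ μ g + τ ^ 2 * (‖g‖ ^ 2 - d)| := by congr 1; ring
        _ ≤ _ := by
          refine (abs_add_le _ _).trans (le_of_eq ?_)
          rw [abs_mul (2 * τ), abs_mul (τ ^ 2), abs_of_nonneg (by positivity : 0 ≤ 2 * τ),
            abs_of_nonneg (by positivity : 0 ≤ τ ^ 2)]
  have hint1 : Integrable (fun g : 𝔼 => (R ^ 4 + 2 * R ^ 2 * τ * inner ℝ μ g
      + τ ^ 2 * (inner ℝ μ g : ℝ) ^ 2) / D) (stdGaussian 𝔼) :=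
    (((integrable_const _).add (hi1.const_mul _)).add (hi2.const_mul _)).div_const _
  have hint2 : Integrable (fun g : 𝔼 => R ^ 2 * (2 * τ * |(inner ℝ μ g : ℝ)|
      + τ ^ 2 * |‖g‖ ^ 2 - d|) / D) (stdGaussian 𝔼) :=
    (((hi1.abs.const_mul _).add (hi3.const_mul _)).const_mul _).div_const _
  have hE1 := integral_inner_stdGaussian μ
  have hE2 := integral_inner_sq_stdGaussian μ
  have hE3 := integral_abs_inner_stdGaussian_le μ
  have hE4 := integral_abs_norm_sq_sub_stdGaussian_le (d := d)
  calc _ ≤ ∫ g, ((R ^ 4 + 2 * R ^ 2 * τ * inner ℝ μ g + τ ^ 2 * (inner ℝ μ g : ℝ) ^ 2) / D +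
        R ^ 2 * (2 * τ * |(inner ℝ μ g : ℝ)| + τ ^ 2 * |‖g‖ ^ 2 - d|) / D) ∂(stdGaussian 𝔼) :=
        integral_mono_of_nonneg (.of_forall fun g => sq_nonneg _) (hint1.add hint2)
          (.of_forall hpt)
    _ ≤ (R ^ 4 + τ ^ 2 * R ^ 2) / D + R ^ 2 * (2 * τ * R + τ ^ 2 * (10 * √d)) / D := by
        have I1 : ∫ g, (R ^ 4 + 2 * R ^ 2 * τ * inner ℝ μ g + τ ^ 2 * (inner ℝ μ g : ℝ) ^ 2)
            ∂(stdGaussian 𝔼) = R ^ 4 + τ ^ 2 * R ^ 2 := by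
          have ic : Integrable (fun _ : 𝔼 => R ^ 4) (stdGaussian 𝔼) := integrable_const _
          have il : Integrable (fun g => R ^ 4 + 2 * R ^ 2 * τ * (inner ℝ μ g : ℝ))
            (stdGaussian 𝔼) := ic.add (hi1.const_mul _)
          rw [integral_add il (hi2.const_mul _), integral_add ic (hi1.const_mul _),
            integral_const_mul, integral_const_mul, hE1, hE2]
          simp [hR]
        have I2 : ∫ g, (2 * τ * |(inner ℝ μ g : ℝ)| + τ ^ 2 * |‖g‖ ^ 2 - d|)
            ∂(stdGaussian 𝔼) ≤ 2 * τ * R + τ ^ 2 * (10 * √d) := by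
          rw [integral_add (hi1.abs.const_mul _) (hi3.const_mul _), integral_const_mul,
            integral_const_mul]
          gcongr
        rw [integral_add hint1 hint2, integral_div, integral_div, integral_const_mul, I1]
        gcongr
    _ ≤ _ := by
        have a1 : τ ^ 2 * R ^ 2 / D ≤ 1 := by
          rw [div_le_one hDpos]
          have : τ ^ 2 ≤ 1 := pow_le_one₀ hτ hτ1
          calc _ ≤ 1 * R ^ 2 := by gcongr
            _ ≤ D := by linarith
        have hs' : R ^ 4 ≤ s * D := (div_le_iff₀ hDpos).1 hs
        have a2 : R ^ 2 * (τ * R) / D ≤ √s := by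
          refine Real.le_sqrt_of_sq_le ?_
          rw [div_pow, div_le_iff₀ (by positivity)]
          have : τ ^ 2 ≤ 1 := pow_le_one₀ hτ hτ1
          calc _ = R ^ 4 * (τ ^ 2 * R ^ 2) := by ring
            _ ≤ (s * D) * (1 * D) := by gcongr
            _ = _ := by ring
        have a3 : R ^ 2 * (τ ^ 2 * √d) / D ≤ √s := by
          refine Real.le_sqrt_of_sq_le ?_
          rw [div_pow, div_le_iff₀ (by positivity)]
          have : τ ^ 2 ≤ 1 := pow_le_one₀ hτ hτ1
          calc _ = R ^ 4 * (τ ^ 2 * (τ ^ 2 * √d ^ 2)) := by ring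
            _ = R ^ 4 * (τ ^ 2 * (τ ^ 2 * d)) := by rw [Real.sq_sqrt (Nat.cast_nonneg d)]
            _ ≤ (s * D) * (1 * D) := by gcongr
            _ = _ := by ring
        calc _ = R ^ 4 / D + τ ^ 2 * R ^ 2 / D + 2 * (R ^ 2 * (τ * R) / D) +
              10 * (R ^ 2 * (τ ^ 2 * √d) / D) := by ring
          _ ≤ _ := by linarith

/-- Lower bound for the attribute testing error given the mean vector. -/
theorem exp_le_lintegral_exp_projLength (hn : 2 ≤ n) (i : Fin n) (y : Labels n) (μ : 𝔼)
    (hμ : 0 < ‖μ‖) {s : ℝ} (hs : ‖μ‖ ^ 4 / (‖μ‖ ^ 2 + d / (n - 1 : ℕ)) ≤ s) :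
    ENNReal.ofReal (Real.exp (-(s / 2 + 7 * √s + 7))) ≤
      ∫⁻ z, ENNReal.ofReal (Real.exp
        (-(projLength (((n - 1 : ℕ) : ℝ) • μ + signedSum i y z) μ ^ 2 / 2 +
          projLength (((n - 1 : ℕ) : ℝ) • μ + signedSum i y z) μ)))
        ∂(Measure.pi fun _ : Fin n => stdGaussian 𝔼) := by
  obtain ⟨k, hk⟩ : ∃ k : ℝ, k = ((n - 1 : ℕ) : ℝ) := ⟨_, rfl⟩
  have hk1 : 1 ≤ k := by rw [hk]; exact_mod_cast (by omega : 1 ≤ n - 1)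
  have hk0 : 0 < k := by linarith
  -- A signed sum of k = n - 1 independent standard Gaussian vectors has the law of √k g.
  have hlaw : (Measure.pi fun _ : Fin n => stdGaussian 𝔼).map (signedSum i y) =
      (stdGaussian 𝔼).map (fun g => √k • g) := by
    have hc : (Finset.univ.erase i).card = n - 1 := by simp
    rw [← map_sum_smul_pi_stdGaussian (fun j => if j = i then 0 else sgn (y j)) (r := √k)]
    · congr 1
      ext1 z
      rw [signedSum, ← Finset.add_sum_erase _ _ (Finset.mem_univ i), if_pos rfl, zero_smul,
        zero_add]
      exact Finset.sum_congr rfl fun j hj => by rw [if_neg (Finset.ne_of_mem_erase hj)]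
    · rw [← Finset.add_sum_erase _ _ (Finset.mem_univ i), if_pos rfl, Real.sq_sqrt hk0.le,
        Finset.sum_congr rfl (g := fun _ => (1 : ℝ)), Finset.sum_const, hc, hk]
      · simp
      · intro j hj
        rw [if_neg (Finset.ne_of_mem_erase hj), sq, sgn_mul_self]
  rw [← hk] at hs ⊢
  have hτ : (√k)⁻¹ ^ 2 * d = d / k := by
    rw [inv_pow, Real.sq_sqrt hk0.le]; ring
  have hmP : Measurable fun w : 𝔼 => projLength w μ := by unfold projLength; fun_prop
  have hF : Measurable fun w : 𝔼 => ENNReal.ofReal (Real.exp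
      (-(projLength (k • μ + w) μ ^ 2 / 2 + projLength (k • μ + w) μ))) := by
    unfold projLength; fun_prop
  rw [← lintegral_map hF (measurable_signedSum i y), hlaw, lintegral_map hF (by fun_prop)]
  -- The projection length does not depend on the scale of the direction, so kμ + √k g may be
  -- divided by k. This is the case τ = 1/√k, and τ ≤ 1 because n ≥ 2.
  have hscale : ∀ g : 𝔼, projLength (k • μ + √k • g) μ = projLength (μ + (√k)⁻¹ • g) μ := by
    intro g
    rw [← projLength_smul hk0.ne' (μ + (√k)⁻¹ • g), smul_add, smul_smul]
    congr 3
    rw [← div_eq_mul_inv, Real.div_sqrt]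
  simp_rw [hscale]
  have hmg : Measurable fun g : 𝔼 => projLength (μ + (√k)⁻¹ • g) μ :=
    hmP.comp (by fun_prop)
  have hLp : MemLp (fun g : 𝔼 => projLength (μ + (√k)⁻¹ • g) μ) 2 (stdGaussian 𝔼) :=
    MemLp.of_bound hmg.aestronglyMeasurable ‖μ‖ (.of_forall fun g => by
      rw [Real.norm_eq_abs, abs_of_nonneg (projLength_nonneg _ _)]
      exact projLength_le_norm _ _)
  have hs0 : 0 ≤ s := le_trans (by positivity) hs
  have hsq := integral_projLength_sq_le μ hμ (τ := (√k)⁻¹) (by positivity)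
    (inv_le_one_of_one_le₀ (Real.one_le_sqrt.2 hk1)) (s := s) (by rwa [hτ])
  -- (√s + 6)² exceeds s + 12√s + 1. Half of the latter plus √s + 6 is then at most s/2 + 7√s + 7.
  have habs : ∫ g, |projLength (μ + (√k)⁻¹ • g) μ| ∂(stdGaussian 𝔼) ≤ √s + 6 := by
    refine integral_abs_le_of_integral_sq_le hLp (by positivity) (hsq.trans ?_)
    have := Real.sq_sqrt hs0
    nlinarith [Real.sqrt_nonneg s]
  simp_rw [abs_of_nonneg (projLength_nonneg _ _)] at habs
  have hint1 : Integrable (fun g : 𝔼 => projLength (μ + (√k)⁻¹ • g) μ ^ 2 / 2)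
    (stdGaussian 𝔼) := hLp.integrable_sq.div_const 2
  have hint2 : Integrable (fun g : 𝔼 => projLength (μ + (√k)⁻¹ • g) μ)
    (stdGaussian 𝔼) := hLp.integrable (by simp)
  refine le_trans (ENNReal.ofReal_le_ofReal (Real.exp_le_exp.2 ?_))
    (ofReal_exp_integral_le_lintegral (hint1.add hint2).neg)
  have hE : ∫ g, -(projLength (μ + (√k)⁻¹ • g) μ ^ 2 / 2 + projLength (μ + (√k)⁻¹ • g) μ)
      ∂(stdGaussian 𝔼) = -((∫ g, projLength (μ + (√k)⁻¹ • g) μ ^ 2 ∂(stdGaussian 𝔼)) / 2 +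
        ∫ g, projLength (μ + (√k)⁻¹ • g) μ ∂(stdGaussian 𝔼)) := by
    rw [integral_neg, integral_add hint1 hint2, integral_div]
  refine le_trans ?_ hE.symm.le
  linarith

/-! ### Overlap of the network likelihoods -/

/-- The probability mass function of the Bernoulli distribution. -/
noncomputable def bern (p : ℝ) (b : Fin 2) : ℝ := if b = 1 then p else 1 - p

theorem bern_pos {p : ℝ} (h0 : 0 < p) (h1 : p < 1) (b : Fin 2) : 0 < bern p b := by
  unfold bern; split_ifs <;> linarith

theorem sum_bern (p : ℝ) : ∑ b, bern p b = 1 := by simp [bern]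

theorem bernoulliLaw_singleton {p : ℝ} (b : Fin 2) :
    bernoulliLaw p {b} = ENNReal.ofReal (bern p b) := by
  fin_cases b <;> simp [bernoulliLaw, bern, ENNReal.ofReal]

/-- The edge probability of a pair of nodes. -/
noncomputable def edgeProb (y : Labels n) (α β : ℝ) (p : Pairs n) : ℝ :=
  if y p.1.1 = y p.1.2 then α else β

theorem edgeProb_pos {α β : ℝ} (hα : 0 < α) (hβ : 0 < β) (y : Labels n) (p : Pairs n) :
    0 < edgeProb y α β p := by unfold edgeProb; split_ifs <;> assumption

theorem edgeProb_lt_one {α β : ℝ} (hα : α < 1) (hβ : β < 1) (y : Labels n) (p : Pairs n) :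
    edgeProb y α β p < 1 := by unfold edgeProb; split_ifs <;> assumption

/-- The likelihood of the edge configuration `e` under the labels `y`. -/
noncomputable def edgeWeight (y : Labels n) (α β : ℝ) (e : Pairs n → Fin 2) : ℝ :=
  ∏ p, bern (edgeProb y α β p) (e p)

theorem lintegral_sbm {α β : ℝ} (hα0 : 0 < α) (hα1 : α < 1) (hβ0 : 0 < β) (hβ1 : β < 1)
    (y : Labels n) (f : Adj n → ENNReal) :
    ∫⁻ A, f A ∂(sbm y α β) =
      ∑ e : Pairs n → Fin 2, f (symmetrize e) * ENNReal.ofReal (edgeWeight y α β e) := by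
  rw [sbm, lintegral_map Measurable.of_discrete measurable_symmetrize, lintegral_fintype]
  refine Finset.sum_congr rfl fun e _ => ?_
  rw [Measure.pi_singleton, edgeWeight, ENNReal.ofReal_prod_of_nonneg fun p _ =>
    (bern_pos (edgeProb_pos hα0 hβ0 y p) (edgeProb_lt_one hα1 hβ1 y p) _).le]
  congr 1
  exact Finset.prod_congr rfl fun p _ => bernoulliLaw_singleton _

/-- The pairs containing the node `i`. -/
abbrev PairsAt (i : Fin n) : Type := {p : Pairs n // p.1.1 = i ∨ p.1.2 = i}

/-- A pair containing i is determined by its other endpoint. -/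
theorem card_pairsAt_le (i : Fin n) : Fintype.card (PairsAt i) ≤ n := by
  let f : PairsAt i → Fin n := fun p => if p.1.1.1 = i then p.1.1.2 else p.1.1.1
  have hf : Function.Injective f := by
    rintro ⟨⟨⟨a, b⟩, hab⟩, h⟩ ⟨⟨⟨c, d⟩, hcd⟩, h'⟩ he
    simp only [f] at he h h' hab hcd
    simp only [Subtype.mk.injEq, Prod.mk.injEq]
    split_ifs at he <;> grind
  simpa using Fintype.card_le_of_injective f hf

theorem edgeProb_flipAt {i : Fin n} {p : Pairs n} (hp : ¬(p.1.1 = i ∨ p.1.2 = i)) (y : Labels n)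
    (α β : ℝ) : edgeProb (flipAt i y) α β p = edgeProb y α β p := by
  push Not at hp
  rw [edgeProb, edgeProb, flipAt_of_ne hp.1, flipAt_of_ne hp.2]

theorem sum_prod_bern {ι : Type*} [Fintype ι] [DecidableEq ι] (θ : ι → ℝ) :
    ∑ r : ι → Fin 2, ∏ p, bern (θ p) (r p) = 1 := by
  have := Finset.prod_univ_sum (fun _ : ι => (Finset.univ : Finset (Fin 2)))
    (fun p b => bern (θ p) b)
  rw [Fintype.piFinset_univ] at this
  rw [← this]
  exact Finset.prod_eq_one fun p _ => sum_bern _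

theorem sum_prod_bern_mul {ι : Type*} [Fintype ι] [DecidableEq ι] (θ : ι → ℝ) (i : ι)
    (f : Fin 2 → ℝ) :
    ∑ r : ι → Fin 2, (∏ p, bern (θ p) (r p)) * f (r i) = ∑ b, bern (θ i) b * f b := by
  have h := Finset.prod_univ_sum (fun _ : ι => (Finset.univ : Finset (Fin 2)))
    (fun p b => bern (θ p) b * if p = i then f b else 1)
  rw [Fintype.piFinset_univ] at h
  simp_rw [Finset.prod_mul_distrib, Finset.prod_ite_eq' Finset.univ i,
    if_pos (Finset.mem_univ _)] at h
  rw [← h, ← Finset.mul_prod_erase _ _ (Finset.mem_univ i), Finset.prod_eq_one, mul_one]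
  · simp
  · intro p hp
    simp only [Finset.ne_of_mem_erase hp, if_false, mul_one, sum_bern]

/-- Edges not touching the node `i` cancel from the comparison of likelihoods. -/
theorem sum_min_edgeWeight {α β : ℝ} (hα0 : 0 < α) (hα1 : α < 1) (hβ0 : 0 < β) (hβ1 : β < 1)
    (i : Fin n) (y : Labels n) :
    ∑ e, min (edgeWeight y α β e) (edgeWeight (flipAt i y) α β e) =
      ∑ r : PairsAt i → Fin 2, min (∏ p : PairsAt i, bern (edgeProb y α β p.1) (r p))
        (∏ p : PairsAt i, bern (edgeProb (flipAt i y) α β p.1) (r p)) := by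
  classical
  let P : Pairs n → Prop := fun p => p.1.1 = i ∨ p.1.2 = i
  have hsplit : ∀ (y : Labels n) (e : Pairs n → Fin 2), edgeWeight y α β e =
      (∏ p : {p // P p}, bern (edgeProb y α β p.1) (e p.1)) *
        ∏ p : {p // ¬P p}, bern (edgeProb y α β p.1) (e p.1) := fun y e =>
    (Fintype.prod_subtype_mul_prod_subtype P fun p => bern (edgeProb y α β p) (e p)).symm
  have hnon : ∀ e : Pairs n → Fin 2,
      ∏ p : {p // ¬P p}, bern (edgeProb (flipAt i y) α β p.1) (e p.1) =
        ∏ p : {p // ¬P p}, bern (edgeProb y α β p.1) (e p.1) := fun e =>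
    Finset.prod_congr rfl fun p _ => by rw [edgeProb_flipAt p.2]
  rw [Fintype.sum_equiv (Equiv.piEquivPiSubtypeProd P fun _ => Fin 2) _
    (fun q : ({p // P p} → Fin 2) × ({p // ¬P p} → Fin 2) =>
      min (∏ p : {p // P p}, bern (edgeProb y α β p.1) (q.1 p))
        (∏ p : {p // P p}, bern (edgeProb (flipAt i y) α β p.1) (q.1 p)) *
      ∏ p : {p // ¬P p}, bern (edgeProb y α β p.1) (q.2 p)), Fintype.sum_prod_type]
  · refine Finset.sum_congr rfl fun r _ => ?_
    dsimp only
    rw [← Finset.mul_sum, sum_prod_bern, mul_one]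
  · intro e
    rw [hsplit, hsplit, hnon, min_mul_of_nonneg]
    · rfl
    · exact Finset.prod_nonneg fun p _ =>
        (bern_pos (edgeProb_pos hα0 hβ0 y _) (edgeProb_lt_one hα1 hβ1 y _) _).le

/-- The product of the two labels of a pair. -/
noncomputable def pairSign (y : Labels n) (p : Pairs n) : ℝ := sgn (y p.1.1) * sgn (y p.1.2)

theorem pairSign_mul_self (y : Labels n) (p : Pairs n) : pairSign y p * pairSign y p = 1 := by
  rw [pairSign, mul_mul_mul_comm, sgn_mul_self, sgn_mul_self, one_mul]

theorem pairSign_flipAt {j : Fin n} {p : Pairs n} (hp : p.1.1 = j ∨ p.1.2 = j) (y : Labels n) :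
    pairSign (flipAt j y) p = -pairSign y p := by
  rcases hp with h | h
  · have h2 : p.1.2 ≠ j := h ▸ p.2.ne'
    rw [pairSign, flipAt_of_ne h2, h, flipAt_same, sgn_neg, pairSign, h, neg_mul]
  · have h2 : p.1.1 ≠ j := h ▸ p.2.ne
    rw [pairSign, flipAt_of_ne h2, h, flipAt_same, sgn_neg, pairSign, h, mul_neg]

theorem pairSign_flipAt_of_notMem {j : Fin n} {p : Pairs n} (hp : ¬(p.1.1 = j ∨ p.1.2 = j))
    (y : Labels n) : pairSign (flipAt j y) p = pairSign y p := by
  push Not at hp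
  rw [pairSign, flipAt_of_ne hp.1, flipAt_of_ne hp.2, pairSign]

/-- Distinct pairs are separated by a node j of the first that is not in the second. Flipping the
label j reverses the sign of the summand. -/
theorem sum_pairSign_mul {p p' : Pairs n} (h : p ≠ p') :
    ∑ y : Labels n, pairSign y p * pairSign y p' = 0 := by
  obtain ⟨j, hj, hj'⟩ : ∃ j, (p.1.1 = j ∨ p.1.2 = j) ∧ ¬(p'.1.1 = j ∨ p'.1.2 = j) := by
    obtain ⟨⟨a, b⟩, hab⟩ := p
    obtain ⟨⟨c, d⟩, hcd⟩ := p'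
    by_contra hcon
    push Not at hcon
    have h1 := hcon a (Or.inl rfl)
    have h2 := hcon b (Or.inr rfl)
    apply h
    simp only [Subtype.mk.injEq, Prod.mk.injEq] at *
    grind
  have := Equiv.sum_comp (flipAt_involutive j).toPerm
    (fun y : Labels n => pairSign y p * pairSign y p')
  simp only [Function.Involutive.coe_toPerm, pairSign_flipAt hj,
    pairSign_flipAt_of_notMem hj', neg_mul, Finset.sum_neg_distrib] at this
  linarith

theorem sum_sq_sum_pairSign {ι : Type*} [Fintype ι] [DecidableEq ι] (P : ι → Pairs n)
    (hP : Function.Injective P) (t : ι → ℝ) :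
    ∑ y : Labels n, (∑ p, pairSign y (P p) * t p) ^ 2 =
      Fintype.card (Labels n) * ∑ p, t p ^ 2 := by
  simp_rw [sq, Finset.sum_mul_sum]
  rw [Finset.sum_comm, Finset.mul_sum]
  refine Finset.sum_congr rfl fun p _ => ?_
  rw [Finset.sum_comm, Finset.sum_eq_single p]
  · have : ∀ y : Labels n, pairSign y (P p) * t p * (pairSign y (P p) * t p) = t p * t p :=
      fun y => by rw [mul_mul_mul_comm, pairSign_mul_self, one_mul]
    simp [this]
  · intro p' _ hne
    have : ∀ y : Labels n, pairSign y (P p) * t p * (pairSign y (P p') * t p') =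
        (pairSign y (P p) * pairSign y (P p')) * (t p * t p') := fun y => by ring
    simp_rw [this]
    rw [← Finset.sum_mul, sum_pairSign_mul (fun h => hne (hP h).symm), zero_mul]
  · simp

/-- Puts the labels into a single sign: a flip at an endpoint keeps the geometric mean of the two
Bernoulli weights and inverts the other factor. -/
theorem bern_edgeProb_eq_exp {α β : ℝ} (hα0 : 0 < α) (hα1 : α < 1) (hβ0 : 0 < β) (hβ1 : β < 1)
    (y : Labels n) (p : Pairs n) (b : Fin 2) :
    bern (edgeProb y α β p) b = Real.exp ((Real.log (bern α b) + Real.log (bern β b)) / 2 +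
      pairSign y p * (Real.log (bern α b) - Real.log (bern β b)) / 2) := by
  have h1 := bern_pos hα0 hα1 b
  have h2 := bern_pos hβ0 hβ1 b
  unfold edgeProb pairSign
  split_ifs with h
  · rw [h, sgn_mul_self]
    conv_lhs => rw [← Real.exp_log h1]
    congr 1; ring
  · have h' : y p.1.1 = -y p.1.2 := by
      rcases Int.units_eq_one_or (y p.1.1) with h3 | h3 <;>
      rcases Int.units_eq_one_or (y p.1.2) with h4 | h4 <;> simp_all
    rw [h', sgn_neg, neg_mul, sgn_mul_self]
    conv_lhs => rw [← Real.exp_log h2]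
    congr 1; ring

/-- Jensen for exp under the product of the uniform law on A and Q. Only the joint average of g has
to be bounded, not its average for each a. -/
theorem card_mul_exp_le_sum {A B : Type*} [Fintype A] [Nonempty A] [Fintype B] (Q : B → ℝ)
    (hQ0 : ∀ b, 0 ≤ Q b) (hQ1 : ∑ b, Q b = 1) (g : A → B → ℝ) {c V : ℝ}
    (hg : ∑ a, ∑ b, Q b * g a b ≤ Fintype.card A * V) :
    Fintype.card A * Real.exp (-(c + V)) ≤ ∑ a, ∑ b, Q b * Real.exp (-c - g a b) := by
  have hN : (0 : ℝ) < Fintype.card A := by exact_mod_cast Fintype.card_pos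
  have hJ := convexOn_exp.map_sum_le (t := (Finset.univ : Finset (A × B)))
    (w := fun x => (Fintype.card A : ℝ)⁻¹ * Q x.2) (p := fun x => -c - g x.1 x.2)
    (fun x _ => mul_nonneg (by positivity) (hQ0 _))
    (by
      rw [Fintype.sum_prod_type]
      simp_rw [← Finset.mul_sum, hQ1]
      simp)
    (fun _ _ => Set.mem_univ _)
  rw [Fintype.sum_prod_type, Fintype.sum_prod_type] at hJ
  simp only [smul_eq_mul, mul_assoc, ← Finset.mul_sum] at hJ
  rw [le_inv_mul_iff₀ hN] at hJ
  refine le_trans (mul_le_mul_of_nonneg_left (Real.exp_le_exp.2 ?_) hN.le) hJ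
  rw [le_inv_mul_iff₀ hN]
  simp_rw [mul_sub, Finset.sum_sub_distrib, ← Finset.sum_mul, hQ1]
  simp only [Finset.sum_const, Finset.card_univ, nsmul_eq_mul]
  linarith

/-- Lower bound for the average overlap of the network likelihoods under a label flip. -/
theorem network_overlap_le {α β θ ζ V κ : ℝ} (hα0 : 0 < α) (hα1 : α < 1) (hβ0 : 0 < β)
    (hβ1 : β < 1) (hθ0 : 0 < θ) (hθ1 : θ < 1) (hκ : 0 < κ) (i : Fin n) (hζ0 : 0 ≤ ζ)
    (hζ : ∀ b, -ζ ≤ (Real.log (bern α b) + Real.log (bern β b)) / 2 - Real.log (bern θ b))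
    (hV : n * ∑ b, bern θ b * (Real.log (bern α b) - Real.log (bern β b)) ^ 2 ≤ V) :
    Fintype.card (Labels n) * Real.exp (-(n * ζ + κ / 4 + V / (4 * κ))) ≤
      ∑ y : Labels n, ∑ e, min (edgeWeight y α β e) (edgeWeight (flipAt i y) α β e) := by
  classical
  simp_rw [sum_min_edgeWeight hα0 hα1 hβ0 hβ1 i]
  let t : Fin 2 → ℝ := fun b => Real.log (bern α b) - Real.log (bern β b)
  let S : Labels n → (PairsAt i → Fin 2) → ℝ := fun y r => ∑ p, pairSign y p.1 * t (r p)
  let Q : (PairsAt i → Fin 2) → ℝ := fun r => ∏ p, bern θ (r p)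
  have hQ0 : ∀ r, 0 ≤ Q r := fun r => Finset.prod_nonneg fun p _ => (bern_pos hθ0 hθ1 _).le
  have hQ1 : ∑ r, Q r = 1 := sum_prod_bern _
  have hN : (0 : ℝ) < Fintype.card (Labels n) := by exact_mod_cast Fintype.card_pos
  have hprod : ∀ (f : Fin 2 → ℝ) (u : PairsAt i → ℝ) (r : PairsAt i → Fin 2),
      (∑ p, f (r p)) + (∑ p, u p) / 2 = ∑ p, (f (r p) + u p / 2) := fun f u r => by
    rw [Finset.sum_add_distrib, Finset.sum_div]
  -- The likelihoods are exp(m ± S/2), so their minimum is exp(m - |S|/2), where m ≥ log Q - nζ.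
  -- Then |S|/2 ≤ S²/(4κ) + κ/4 brings in S², whose average over y can be computed.
  have hmin : ∀ y r, Q r * Real.exp (-(n * ζ + κ / 4) - S y r ^ 2 / (4 * κ)) ≤
      min (∏ p : PairsAt i, bern (edgeProb y α β p.1) (r p))
        (∏ p : PairsAt i, bern (edgeProb (flipAt i y) α β p.1) (r p)) := by
    intro y r
    have hQe : Q r = Real.exp (∑ p, Real.log (bern θ (r p))) := by
      rw [Real.exp_sum]
      exact Finset.prod_congr rfl fun p _ => (Real.exp_log (bern_pos hθ0 hθ1 _)).symm
    have hsum : -(n * ζ) ≤ ∑ p : PairsAt i,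
        ((Real.log (bern α (r p)) + Real.log (bern β (r p))) / 2 - Real.log (bern θ (r p))) := by
      calc -(n * ζ) ≤ ∑ p : PairsAt i, -ζ := by
            simp only [Finset.sum_const, Finset.card_univ, nsmul_eq_mul, mul_neg, neg_le_neg_iff]
            gcongr
            exact card_pairsAt_le i
        _ ≤ _ := Finset.sum_le_sum fun p _ => hζ _
    rw [Finset.sum_sub_distrib] at hsum
    have habs : |S y r| / 2 ≤ S y r ^ 2 / (4 * κ) + κ / 4 := by
      rw [← sub_nonneg]
      have : S y r ^ 2 / (4 * κ) + κ / 4 - |S y r| / 2 = (|S y r| - κ) ^ 2 / (4 * κ) := by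
        rw [← sq_abs (S y r)]
        field_simp
        ring
      rw [this]
      positivity
    refine le_min ?_ ?_
    · simp_rw [bern_edgeProb_eq_exp hα0 hα1 hβ0 hβ1]
      rw [← Real.exp_sum, hQe, ← Real.exp_add, Real.exp_le_exp, Finset.sum_add_distrib,
        ← Finset.sum_div _ (fun p : PairsAt i => pairSign y p.1 *
          (Real.log (bern α (r p)) - Real.log (bern β (r p))))]
      have : -|S y r| ≤ S y r := neg_abs_le _
      change _ ≤ _ + S y r / 2
      linarith
    · simp_rw [bern_edgeProb_eq_exp hα0 hα1 hβ0 hβ1]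
      rw [← Real.exp_sum, hQe, ← Real.exp_add, Real.exp_le_exp, Finset.sum_add_distrib,
        ← Finset.sum_div _ (fun p : PairsAt i => pairSign (flipAt i y) p.1 *
          (Real.log (bern α (r p)) - Real.log (bern β (r p))))]
      have : S y r ≤ |S y r| := le_abs_self _
      have hneg : ∑ p : PairsAt i, pairSign (flipAt i y) p.1 *
          (Real.log (bern α (r p)) - Real.log (bern β (r p))) = -S y r := by
        rw [← Finset.sum_neg_distrib]
        exact Finset.sum_congr rfl fun p _ => by rw [pairSign_flipAt p.2, neg_mul]
      rw [hneg]
      linarith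
  -- Summing over y with r fixed kills all cross terms. Under Q alone S need not be centred.
  have hSV : ∑ y : Labels n, ∑ r, Q r * S y r ^ 2 ≤ Fintype.card (Labels n) * V := by
    rw [Finset.sum_comm]
    have h1 : ∀ r, ∑ y : Labels n, Q r * S y r ^ 2 =
        Fintype.card (Labels n) * ∑ p : PairsAt i, Q r * t (r p) ^ 2 := fun r => by
      rw [← Finset.mul_sum, sum_sq_sum_pairSign (fun p : PairsAt i => p.1)
        Subtype.val_injective, ← Finset.mul_sum]
      ring
    simp_rw [h1]
    rw [← Finset.mul_sum, Finset.sum_comm]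
    refine mul_le_mul_of_nonneg_left ?_ hN.le
    have h2 : ∀ p : PairsAt i, ∑ r, Q r * t (r p) ^ 2 = ∑ b, bern θ b * t b ^ 2 := fun p =>
      sum_prod_bern_mul (fun _ => θ) p fun b => t b ^ 2
    simp_rw [h2]
    rw [Finset.sum_const, nsmul_eq_mul, Finset.card_univ]
    refine le_trans (mul_le_mul_of_nonneg_right (Nat.cast_le.2 (card_pairsAt_le i)) ?_) hV
    exact Finset.sum_nonneg fun b _ => mul_nonneg (bern_pos hθ0 hθ1 b).le (sq_nonneg _)
  have hJ := card_mul_exp_le_sum (A := Labels n) Q hQ0 hQ1 (fun y r => S y r ^ 2 / (4 * κ))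
    (c := n * ζ + κ / 4) (V := V / (4 * κ)) (by
      have e : ∀ y : Labels n, ∑ r, Q r * (S y r ^ 2 / (4 * κ)) =
          (∑ r, Q r * S y r ^ 2) / (4 * κ) := fun y => by
        rw [Finset.sum_div]
        exact Finset.sum_congr rfl fun r _ => by ring
      simp_rw [e]
      rw [← Finset.sum_div, ← mul_div_assoc]
      exact div_le_div_of_nonneg_right hSV (by positivity))
  exact hJ.trans (Finset.sum_le_sum fun y _ => Finset.sum_le_sum fun r _ => hmin y r)

/-! ### From misclassified nodes to misjudged pairs -/

/-- If u = s v at both endpoints, then s² = 1 makes the products agree. A misjudged ordered pair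
therefore has a bad node in one of its two positions. -/
theorem card_pairs_ne_le (u v : Labels n) (s : ℤˣ) :
    (Finset.univ.filter fun p : Fin n × Fin n => u p.1 * u p.2 ≠ v p.1 * v p.2).card ≤
      2 * n * (Finset.univ.filter fun i => u i ≠ s * v i).card := by
  classical
  have hsub : (Finset.univ.filter fun p : Fin n × Fin n => u p.1 * u p.2 ≠ v p.1 * v p.2) ⊆
      (Finset.univ.filter fun i => u i ≠ s * v i) ×ˢ Finset.univ ∪
        Finset.univ ×ˢ (Finset.univ.filter fun i => u i ≠ s * v i) := by
    intro p hp
    simp only [Finset.mem_filter, Finset.mem_univ, true_and, Finset.mem_union,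
      Finset.mem_product, and_true] at hp ⊢
    by_contra! h
    rw [h.1, h.2, mul_mul_mul_comm, Int.units_mul_self, one_mul] at hp
    exact hp rfl
  refine (Finset.card_le_card hsub).trans ((Finset.card_union_le _ _).trans ?_)
  rw [Finset.card_product, Finset.card_product, Finset.card_univ, Fintype.card_fin]
  linarith

theorem sum_pairs_ne_le_mismatch (hn : 0 < n) (u v : Labels n) :
    (2 * (n : ℝ) ^ 2)⁻¹ * ∑ i, ∑ j, (if u i * u j ≠ v i * v j then 1 else 0) ≤
      mismatch u v := by
  have hn' : (0 : ℝ) < n := by exact_mod_cast hn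
  have h1 := card_pairs_ne_le u v 1
  have h2 := card_pairs_ne_le u v (-1)
  simp only [one_mul, neg_one_mul] at h1 h2
  have hcard : (∑ i, ∑ j, (if u i * u j ≠ v i * v j then 1 else 0) : ℝ) =
      (Finset.univ.filter fun p : Fin n × Fin n => u p.1 * u p.2 ≠ v p.1 * v p.2).card := by
    rw [← Fintype.sum_prod_type' (f := fun i j => if u i * u j ≠ v i * v j then (1 : ℝ) else 0),
      Finset.sum_boole]
  rw [hcard, mismatch, inv_mul_le_iff₀ (by positivity)]
  have e : ∀ x : ℝ, 2 * (n : ℝ) ^ 2 * ((n : ℝ)⁻¹ * x) = 2 * n * x := fun x => by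
    field_simp
  rw [e, mul_min_of_nonneg _ _ (by positivity)]
  refine le_min ?_ ?_
  · exact_mod_cast h1
  · exact_mod_cast h2

/-! ### Combination of the two tests and the finite-sample bound -/

theorem labelPrior_singleton (y : Labels n) :
    labelPrior n {y} = (Fintype.card (Labels n) : ENNReal)⁻¹ := by
  rw [labelPrior, PMF.toMeasure_apply_singleton _ _ (MeasurableSet.singleton y),
    PMF.uniformOfFintype_apply]

instance isProbabilityMeasure_labelPrior : IsProbabilityMeasure (labelPrior n) := by
  unfold labelPrior; infer_instance

theorem csbm_apply (hd : 1 ≤ d) {α β : ℝ} (hα0 : 0 < α) (hα1 : α < 1) (hβ0 : 0 < β)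
    (hβ1 : β < 1) (R : ℝ)
    {S : Set ((Labels n × EuclideanSpace ℝ (Fin d)) × (Adj n × Attr n d))}
    (C : Labels n → Adj n → Set (Attr n d)) (hC : ∀ y A, MeasurableSet (C y A))
    (hS : ∀ ω, ω ∈ S ↔ ω.2.2 ∈ C ω.1.1 ω.2.1) (hSm : MeasurableSet S) :
    csbm n d α β R S = (Fintype.card (Labels n) : ENNReal)⁻¹ *
      ∑ y : Labels n, ∑ e, ENNReal.ofReal (edgeWeight y α β e) *
        ∫⁻ μ, gmm μ y (C y (symmetrize e)) ∂(spherePrior d R) := by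
  have := isProbabilityMeasure_spherePrior hd R
  rw [csbm, Measure.compProd_apply hSm, lintegral_prod _
    (Kernel.measurable_kernel_prodMk_left hSm).aemeasurable, lintegral_fintype, Finset.mul_sum]
  refine Finset.sum_congr rfl fun y _ => ?_
  rw [labelPrior_singleton, mul_comm]
  congr 1
  have hpt : ∀ μ : EuclideanSpace ℝ (Fin d),
      csbmKernel n d α β (y, μ) (Prod.mk (y, μ) ⁻¹' S) =
        ∑ e, ENNReal.ofReal (edgeWeight y α β e) * gmm μ y (C y (symmetrize e)) := by
    intro μ
    have hm : MeasurableSet (Prod.mk (y, μ) ⁻¹' S) := measurable_prodMk_left hSm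
    change ((sbm y α β).prod (gmm μ y)) (Prod.mk (y, μ) ⁻¹' S) = _
    rw [Measure.prod_apply hm, lintegral_sbm hα0 hα1 hβ0 hβ1]
    refine Finset.sum_congr rfl fun e _ => ?_
    rw [mul_comm]
    congr 2
    ext X
    exact hS ((y, μ), (symmetrize e, X))
  simp_rw [hpt]
  rw [lintegral_finsetSum _ fun e _ => (measurable_gmm_apply y (hC y _)).const_mul _]
  refine Finset.sum_congr rfl fun e _ => ?_
  rw [lintegral_const_mul _ (measurable_gmm_apply y (hC y _))]

/-- Two weighted error probabilities are at least the overlap of the weights times the total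
error. -/
theorem sum_min_mul_le {A B : Type*} [Fintype A] [Fintype B] (φ : A ≃ A) (w : A → B → ℝ)
    (g : A → B → ENNReal) (ε : ENNReal) (hg : ∀ a b, ε ≤ g a b + g (φ a) b) :
    (∑ a, ∑ b, ENNReal.ofReal (min (w a b) (w (φ a) b))) * ε ≤
      2 * ∑ a, ∑ b, ENNReal.ofReal (w a b) * g a b := by
  rw [two_mul]
  conv_rhs =>
    enter [2]
    rw [← Equiv.sum_comp φ]
  rw [← Finset.sum_add_distrib, Finset.sum_mul]
  refine Finset.sum_le_sum fun a _ => ?_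
  rw [← Finset.sum_add_distrib, Finset.sum_mul]
  refine Finset.sum_le_sum fun b _ => ?_
  refine (mul_le_mul_right (hg a b) _).trans ?_
  rw [mul_add]
  gcongr
  · exact min_le_left _ _
  · exact min_le_right _ _

/-- Lower bound on the probability that an estimator misjudges whether two nodes have the same
label. -/
theorem csbm_pair_error_ge (hd : 1 ≤ d) (hn : 2 ≤ n) {α β θ ζ V κ R s : ℝ} (hα0 : 0 < α)
    (hα1 : α < 1) (hβ0 : 0 < β) (hβ1 : β < 1) (hθ0 : 0 < θ) (hθ1 : θ < 1) (hκ : 0 < κ)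
    (hζ0 : 0 ≤ ζ)
    (hζ : ∀ b, -ζ ≤ (Real.log (bern α b) + Real.log (bern β b)) / 2 - Real.log (bern θ b))
    (hV : n * ∑ b, bern θ b * (Real.log (bern α b) - Real.log (bern β b)) ^ 2 ≤ V)
    (hR : 0 < R) (hs : R ^ 4 / (R ^ 2 + d / (n - 1 : ℕ)) ≤ s)
    {yhat : Adj n × Attr n d → Labels n} (hy : Measurable yhat) {i j : Fin n} (hij : i ≠ j) :
    ENNReal.ofReal (Real.exp (-(n * ζ + κ / 4 + V / (4 * κ))) *
        Real.exp (-(s / 2 + 7 * √s + 7))) ≤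
      2 * csbm n d α β R {ω | yhat ω.2 i * yhat ω.2 j ≠ ω.1.1 i * ω.1.1 j} := by
  have := isProbabilityMeasure_spherePrior hd R
  let C : Labels n → Adj n → Set (Attr n d) := fun y A =>
    {X | yhat (A, X) i * yhat (A, X) j ≠ y i * y j}
  have hC : ∀ y A, MeasurableSet (C y A) := fun y A => by
    have h1 : Measurable fun X : Attr n d => yhat (A, X) := hy.comp measurable_prodMk_left
    exact h1 (MeasurableSet.of_discrete (s := {u : Labels n | u i * u j ≠ y i * y j}))
  have hSm : MeasurableSet {ω : (Labels n × EuclideanSpace ℝ (Fin d)) × (Adj n × Attr n d) |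
      yhat ω.2 i * yhat ω.2 j ≠ ω.1.1 i * ω.1.1 j} := by
    have h1 : Measurable fun ω : (Labels n × EuclideanSpace ℝ (Fin d)) × (Adj n × Attr n d) =>
        (yhat ω.2, ω.1.1) :=
      (hy.comp measurable_snd).prodMk (measurable_fst.comp measurable_fst)
    exact h1 (MeasurableSet.of_discrete
      (s := {p : Labels n × Labels n | p.1 i * p.1 j ≠ p.2 i * p.2 j}))
  have happ := csbm_apply hd hα0 hα1 hβ0 hβ1 R C hC (S := {ω |
    yhat ω.2 i * yhat ω.2 j ≠ ω.1.1 i * ω.1.1 j}) (fun ω => Iff.rfl) hSm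
  rw [happ, mul_left_comm]
  -- Flipping the label i and keeping the label j ≠ i reverses y_i y_j, so an answer is wrong for
  -- exactly one of the two label vectors.
  have hCc : ∀ y A, C (flipAt i y) A = (C y A)ᶜ := fun y A => by
    ext X
    simp only [C, Set.mem_ofPred_eq, Set.mem_compl_iff, not_not]
    rw [flipAt_same, flipAt_of_ne hij.symm, neg_mul, Int.units_ne_iff_eq_neg, neg_neg]
  have hatt : ∀ (y : Labels n) (e : Pairs n → Fin 2),
      ENNReal.ofReal (Real.exp (-(s / 2 + 7 * √s + 7))) ≤
      ∫⁻ μ, gmm μ y (C y (symmetrize e)) ∂(spherePrior d R) +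
        ∫⁻ μ, gmm μ (flipAt i y) (C (flipAt i y) (symmetrize e)) ∂(spherePrior d R) := by
    intro y e
    rw [hCc]
    refine le_trans ?_ (attribute_test_le (spherePrior d R) (spherePrior_map_isometry d R) i y
      (hC y _))
    calc _ = ∫⁻ _, ENNReal.ofReal (Real.exp (-(s / 2 + 7 * √s + 7))) ∂(spherePrior d R) := by
          simp
      _ ≤ _ := lintegral_mono_ae <| by
          filter_upwards [norm_eq_of_spherePrior d hR.le] with μ hμ
          exact exp_le_lintegral_exp_projLength hn i y μ (hμ ▸ hR) (by rwa [hμ])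
  have hmain := sum_min_mul_le (flipAt_involutive i).toPerm (fun y e => edgeWeight y α β e)
    (fun y e => ∫⁻ μ, gmm μ y (C y (symmetrize e)) ∂(spherePrior d R)) _ hatt
  have hnet := network_overlap_le hα0 hα1 hβ0 hβ1 hθ0 hθ1 hκ i hζ0 hζ hV
  have hw0 : ∀ (y : Labels n) (e : Pairs n → Fin 2), 0 ≤ edgeWeight y α β e := fun y e =>
    Finset.prod_nonneg fun p _ =>
      (bern_pos (edgeProb_pos hα0 hβ0 y p) (edgeProb_lt_one hα1 hβ1 y p) _).le
  have hnet' := ENNReal.ofReal_le_ofReal hnet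
  rw [ENNReal.ofReal_sum_of_nonneg fun y _ => Finset.sum_nonneg fun e _ =>
    le_min (hw0 _ _) (hw0 _ _)] at hnet'
  simp_rw [ENNReal.ofReal_sum_of_nonneg fun e _ => le_min (hw0 _ e) (hw0 _ e)] at hnet'
  rw [ENNReal.ofReal_mul (Nat.cast_nonneg _), ENNReal.ofReal_natCast] at hnet'
  have hN0 : (Fintype.card (Labels n) : ENNReal) ≠ 0 := by
    exact_mod_cast Fintype.card_ne_zero
  have hNt : (Fintype.card (Labels n) : ENNReal) ≠ ⊤ := ENNReal.natCast_ne_top _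
  rw [ENNReal.ofReal_mul (Real.exp_pos _).le]
  refine le_trans ?_ (mul_le_mul_right hmain _)
  rw [← ENNReal.mul_le_mul_iff_right hN0 hNt, ← mul_assoc, ← mul_assoc,
    ENNReal.mul_inv_cancel hN0 hNt, one_mul]
  exact mul_le_mul_left hnet' _

/-- A non-asymptotic lower bound on the risk. -/
theorem risk_ge (hd : 1 ≤ d) (hn : 2 ≤ n) {α β θ ζ V κ R s : ℝ} (hα0 : 0 < α)
    (hα1 : α < 1) (hβ0 : 0 < β) (hβ1 : β < 1) (hθ0 : 0 < θ) (hθ1 : θ < 1) (hκ : 0 < κ)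
    (hζ0 : 0 ≤ ζ)
    (hζ : ∀ b, -ζ ≤ (Real.log (bern α b) + Real.log (bern β b)) / 2 - Real.log (bern θ b))
    (hV : n * ∑ b, bern θ b * (Real.log (bern α b) - Real.log (bern β b)) ^ 2 ≤ V)
    (hR : 0 < R) (hs : R ^ 4 / (R ^ 2 + d / (n - 1 : ℕ)) ≤ s)
    {yhat : Adj n × Attr n d → Labels n} (hy : Measurable yhat) :
    ENNReal.ofReal (1 / 8 * Real.exp (-(n * ζ + κ / 4 + V / (4 * κ) +
      (s / 2 + 7 * √s + 7)))) ≤ risk n d α β R yhat := by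
  have hn0 : 0 < n := by omega
  have hnr : (2 : ℝ) ≤ n := by exact_mod_cast hn
  let S : Fin n → Fin n → Set ((Labels n × EuclideanSpace ℝ (Fin d)) × (Adj n × Attr n d)) :=
    fun i j => {ω | yhat ω.2 i * yhat ω.2 j ≠ ω.1.1 i * ω.1.1 j}
  have hSm : ∀ i j, MeasurableSet (S i j) := fun i j => by
    have h1 : Measurable fun ω : (Labels n × EuclideanSpace ℝ (Fin d)) × (Adj n × Attr n d) =>
        (yhat ω.2, ω.1.1) :=
      (hy.comp measurable_snd).prodMk (measurable_fst.comp measurable_fst)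
    exact h1 (MeasurableSet.of_discrete
      (s := {p : Labels n × Labels n | p.1 i * p.1 j ≠ p.2 i * p.2 j}))
  have hpt : ∀ ω, ENNReal.ofReal (2 * (n : ℝ) ^ 2)⁻¹ * ∑ i, ∑ j, (S i j).indicator 1 ω ≤
      ENNReal.ofReal (mismatch (yhat ω.2) ω.1.1) := by
    intro ω
    have h := ENNReal.ofReal_le_ofReal (sum_pairs_ne_le_mismatch hn0 (yhat ω.2) ω.1.1)
    rw [ENNReal.ofReal_mul (by positivity)] at h
    refine le_trans (le_of_eq ?_) h
    congr 1
    rw [ENNReal.ofReal_sum_of_nonneg fun i _ => Finset.sum_nonneg fun j _ => by positivity]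
    refine Finset.sum_congr rfl fun i _ => ?_
    rw [ENNReal.ofReal_sum_of_nonneg fun j _ => by positivity]
    refine Finset.sum_congr rfl fun j _ => ?_
    by_cases hω : ω ∈ S i j
    · have h' : yhat ω.2 i * yhat ω.2 j ≠ ω.1.1 i * ω.1.1 j := hω
      rw [Set.indicator_of_mem hω, if_pos h']; simp
    · have h' : ¬(yhat ω.2 i * yhat ω.2 j ≠ ω.1.1 i * ω.1.1 j) := hω
      rw [Set.indicator_of_notMem hω, if_neg h']; simp
  have hind : ∀ i j, Measurable ((S i j).indicator
      (1 : (Labels n × EuclideanSpace ℝ (Fin d)) × (Adj n × Attr n d) → ENNReal)) := fun i j =>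
    measurable_one.indicator (hSm i j)
  set T := Real.exp (-(n * ζ + κ / 4 + V / (4 * κ))) * Real.exp (-(s / 2 + 7 * √s + 7)) with hT
  have hT0 : 0 < T := by positivity
  have hpair : ∀ i j : Fin n, i ≠ j → ENNReal.ofReal (T / 2) ≤ csbm n d α β R (S i j) := by
    intro i j hij
    have h := csbm_pair_error_ge hd hn hα0 hα1 hβ0 hβ1 hθ0 hθ1 hκ hζ0 hζ hV hR hs hy hij
    rw [ENNReal.ofReal_div_of_pos two_pos, ENNReal.ofReal_ofNat]
    exact ENNReal.div_le_of_le_mul' h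
  calc _ ≤ ENNReal.ofReal ((2 * (n : ℝ) ^ 2)⁻¹ * (n * ((n - 1) * (T / 2)))) := by
        refine ENNReal.ofReal_le_ofReal ?_
        rw [neg_add, Real.exp_add, ← hT]
        -- There are n(n - 1) ordered pairs of distinct nodes, and 1 - 1/n ≥ 1/2 yields the factor
        -- 1/8.
        have : (2 * (n : ℝ) ^ 2)⁻¹ * (n * ((n - 1) * (T / 2))) = (1 - 1 / n) * T / 4 := by
          field_simp
          ring
        rw [this]
        have h2 : 1 / (n : ℝ) ≤ 1 / 2 := one_div_le_one_div_of_le two_pos hnr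
        nlinarith
    _ = ENNReal.ofReal (2 * (n : ℝ) ^ 2)⁻¹ *
        ∑ i : Fin n, ∑ j ∈ Finset.univ.erase i, ENNReal.ofReal (T / 2) := by
        rw [ENNReal.ofReal_mul (by positivity)]
        congr 1
        simp only [Finset.sum_const, Finset.card_erase_of_mem (Finset.mem_univ _),
          Finset.card_univ, Fintype.card_fin, nsmul_eq_mul]
        rw [ENNReal.ofReal_mul (by positivity), ENNReal.ofReal_mul (by linarith),
          ENNReal.ofReal_natCast, ← Nat.cast_pred hn0, ENNReal.ofReal_natCast]
    _ ≤ ENNReal.ofReal (2 * (n : ℝ) ^ 2)⁻¹ * ∑ i, ∑ j, csbm n d α β R (S i j) := by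
        gcongr with i _
        refine (Finset.sum_le_sum fun j hj => hpair i j (Finset.ne_of_mem_erase hj).symm).trans ?_
        exact Finset.sum_le_sum_of_subset (Finset.erase_subset _ _)
    _ = ∫⁻ ω, ENNReal.ofReal (2 * (n : ℝ) ^ 2)⁻¹ * ∑ i, ∑ j, (S i j).indicator 1 ω
          ∂(csbm n d α β R) := by
        rw [lintegral_const_mul _ (Finset.measurable_sum _ fun i _ =>
          Finset.measurable_sum _ fun j _ => hind i j),
          lintegral_finsetSum _ fun i _ => Finset.measurable_sum _ fun j _ => hind i j]
        congr 1
        refine Finset.sum_congr rfl fun i _ => ?_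
        rw [lintegral_finsetSum _ fun j _ => hind i j]
        exact Finset.sum_congr rfl fun j _ => (lintegral_indicator_one (hSm i j)).symm
    _ ≤ _ := lintegral_mono hpt

/-! ### Asymptotics of the exponent -/

theorem neg_two_mul_sq_sub_le_log_one_sub {x : ℝ} (h1 : x ≤ 1 / 2) :
    -x - 2 * x ^ 2 ≤ Real.log (1 - x) := by
  have hpos : 0 < 1 - x := by linarith
  refine le_trans ?_ (Real.one_sub_inv_le_log_of_pos hpos)
  have : 1 - (1 - x)⁻¹ = -x - x ^ 2 / (1 - x) := by
    field_simp
    ring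
  rw [this]
  have : x ^ 2 / (1 - x) ≤ 2 * x ^ 2 := by
    rw [div_le_iff₀ hpos]
    nlinarith [sq_nonneg x]
  linarith

theorem log_one_sub_sq_le {x y : ℝ} (hx0 : 0 ≤ x) (hy0 : 0 ≤ y) (hx : x ≤ 1 / 2)
    (hy : y ≤ 1 / 2) : (Real.log (1 - x) - Real.log (1 - y)) ^ 2 ≤ 4 * (x + y) ^ 2 := by
  have h : ∀ z : ℝ, 0 ≤ z → z ≤ 1 / 2 → -(2 * z) ≤ Real.log (1 - z) ∧ Real.log (1 - z) ≤ 0 := by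
    intro z h0 h1
    refine ⟨le_trans ?_ (neg_two_mul_sq_sub_le_log_one_sub h1),
      Real.log_nonpos (by linarith) (by linarith)⟩
    nlinarith
  have hx' := h x hx0 hx
  have hy' := h y hy0 hy
  have : |Real.log (1 - x) - Real.log (1 - y)| ≤ 2 * (x + y) :=
    abs_le.2 ⟨by linarith, by linarith⟩
  calc _ = |Real.log (1 - x) - Real.log (1 - y)| ^ 2 := (sq_abs _).symm
    _ ≤ (2 * (x + y)) ^ 2 := by gcongr
    _ = _ := by ring

/-- For a present edge the reference parameter is exactly the geometric mean and nothing is lost.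
For an absent edge the first-order loss is (a + b)/2 · r - √(ab) r = (√a - √b)² r/2, which is where
this term of I* comes from. -/
theorem log_bern_mean_ge {a b r : ℝ} (ha : 0 < a) (hb : 0 < b) (hr : 0 < r)
    (har : a * r ≤ 1 / 2) (hbr : b * r ≤ 1 / 2) (hθ : √(a * b) * r < 1) (x : Fin 2) :
    -((√a - √b) ^ 2 / 2 * r + (a ^ 2 + b ^ 2) * r ^ 2) ≤
      (Real.log (bern (a * r) x) + Real.log (bern (b * r) x)) / 2 -
        Real.log (bern (√(a * b) * r) x) := by
  have hab : 0 < a * b := mul_pos ha hb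
  unfold bern
  split_ifs
  · rw [Real.log_mul ha.ne' hr.ne', Real.log_mul hb.ne' hr.ne',
      Real.log_mul (Real.sqrt_pos.2 hab).ne' hr.ne', Real.log_sqrt hab.le,
      Real.log_mul ha.ne' hb.ne']
    have : 0 ≤ (√a - √b) ^ 2 / 2 * r + (a ^ 2 + b ^ 2) * r ^ 2 := by positivity
    linarith
  · have h1 := neg_two_mul_sq_sub_le_log_one_sub har
    have h2 := neg_two_mul_sq_sub_le_log_one_sub hbr
    have h3 := Real.log_le_sub_one_of_pos (x := 1 - √(a * b) * r) (by linarith)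
    have h4 : (√a - √b) ^ 2 = a + b - 2 * √(a * b) := by
      rw [sub_sq, Real.sq_sqrt ha.le, Real.sq_sqrt hb.le, Real.sqrt_mul ha.le]
      ring
    rw [h4]
    linarith

/-- The error constant in the exponent of the risk. -/
noncomputable def errorConst (a b c : ℝ) : ℝ :=
  (a ^ 2 + b ^ 2) + 1 / 4 + (√(a * b) * (Real.log a - Real.log b) ^ 2 + 4 * (a + b) ^ 2) / 4 +
    7 * √c + 7 + Real.log 8

/-- A lower bound on the risk with an explicit error term. -/
theorem risk_ge_exp {n d : ℕ} {a b c q R : ℝ} (ha : 0 < a) (hb : 0 < b) (hc : 0 < c)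
    (hd : 1 ≤ d) (hn : 2 ≤ n) (hq : 1 ≤ q) (hR : 0 < R) (hqn : q ^ 2 ≤ n)
    (haq : a * q / n ≤ 1 / 2) (hbq : b * q / n ≤ 1 / 2)
    (hSNR : R ^ 4 / (R ^ 2 + (d : ℝ) / n) = c * q)
    {yhat : Adj n × Attr n d → Labels n} (hy : Measurable yhat) :
    ENNReal.ofReal (Real.exp (-(IStar a b c * q + errorConst a b c * √q))) ≤
      risk n d (a * q / n) (b * q / n) R yhat := by
  have hn2 : (2 : ℝ) ≤ n := by exact_mod_cast hn
  have hn0 : (0 : ℝ) < n := by linarith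
  have hq0 : 0 < q := by linarith
  have hab : 0 < a * b := mul_pos ha hb
  obtain ⟨r, hr⟩ : ∃ r, r = q / n := ⟨_, rfl⟩
  have hr0 : 0 < r := by rw [hr]; positivity
  have hnr : n * r = q := by rw [hr]; field_simp
  have har : a * q / n = a * r := by rw [hr]; ring
  have hbr : b * q / n = b * r := by rw [hr]; ring
  rw [har] at haq ⊢
  rw [hbr] at hbq ⊢
  have hgm : √(a * b) ≤ (a + b) / 2 := by
    have : 0 ≤ (√a - √b) ^ 2 := sq_nonneg _
    rw [sub_sq, Real.sq_sqrt ha.le, Real.sq_sqrt hb.le] at this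
    rw [Real.sqrt_mul ha.le]
    linarith
  have hθ0 : 0 < √(a * b) * r := by positivity
  have hθ1 : √(a * b) * r < 1 := by nlinarith
  have hnr2 : n * r ^ 2 ≤ 1 := by
    have : n * r ^ 2 = q ^ 2 / n := by rw [hr]; field_simp
    rw [this, div_le_one hn0]
    exact hqn
  have hsq : 1 ≤ √q := Real.one_le_sqrt.2 hq
  have hsq2 : √q ^ 2 = q := Real.sq_sqrt hq0.le
  set K := √(a * b) * (Real.log a - Real.log b) ^ 2 + 4 * (a + b) ^ 2 with hK
  have hK0 : 0 ≤ K := by positivity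
  -- Present edges have weight of order r and a constant log-ratio; absent edges have a squared
  -- log-ratio of order r². As n r = q and n r² ≤ 1, the total is O(q).
  have hV : n * ∑ x, bern (√(a * b) * r) x *
      (Real.log (bern (a * r) x) - Real.log (bern (b * r) x)) ^ 2 ≤ K * q := by
    have h0 := log_one_sub_sq_le (x := a * r) (y := b * r) (by positivity) (by positivity)
      haq hbq
    simp only [bern, Fin.sum_univ_two, zero_ne_one, if_false, if_true]
    rw [Real.log_mul ha.ne' hr0.ne', Real.log_mul hb.ne' hr0.ne', add_sub_add_right_eq_sub]
    calc _ ≤ n * (1 * (4 * (a * r + b * r) ^ 2) +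
          √(a * b) * r * (Real.log a - Real.log b) ^ 2) := by
          gcongr
          linarith
      _ = 4 * (a + b) ^ 2 * (n * r ^ 2) + √(a * b) * (Real.log a - Real.log b) ^ 2 * (n * r) := by
          ring
      _ ≤ 4 * (a + b) ^ 2 * 1 + √(a * b) * (Real.log a - Real.log b) ^ 2 * q := by
          rw [hnr]
          gcongr
      _ ≤ 4 * (a + b) ^ 2 * q + √(a * b) * (Real.log a - Real.log b) ^ 2 * q := by gcongr
      _ = _ := by rw [hK]; ring
  -- Leaving one attribute out raises the noise term from d/n to d/(n - 1), which only helps the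
  -- bound.
  have hs : R ^ 4 / (R ^ 2 + d / (n - 1 : ℕ)) ≤ c * q := by
    rw [← hSNR]
    have : (0 : ℝ) < (n - 1 : ℕ) := by exact_mod_cast (by omega : 0 < n - 1)
    have h2 : ((n - 1 : ℕ) : ℝ) ≤ n := by exact_mod_cast Nat.sub_le n 1
    gcongr
  -- The choice κ = √q balances κ/4 against Kq/(4κ), both then of order √q.
  have key := risk_ge hd hn (α := a * r) (β := b * r) (κ := √q)
    (by positivity) (by linarith) (by positivity) (by linarith) hθ0 hθ1 (by positivity)
    (by positivity) (log_bern_mean_ge ha hb hr0 haq hbq hθ1) hV hR hs hy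
  refine le_trans (ENNReal.ofReal_le_ofReal ?_) key
  have h8 : (1 / 8 : ℝ) = Real.exp (-Real.log 8) := by
    rw [Real.exp_neg, Real.exp_log (by norm_num)]
    norm_num
  rw [h8, ← Real.exp_add, Real.exp_le_exp]
  have e1 : K * q / (4 * √q) = K / 4 * √q := by
    rw [div_eq_iff (by positivity)]
    linear_combination -K * hsq2
  have e2 : √(c * q) = √c * √q := Real.sqrt_mul hc.le q
  have e3 : n * ((√a - √b) ^ 2 / 2 * r + (a ^ 2 + b ^ 2) * r ^ 2) =
      (√a - √b) ^ 2 / 2 * q + (a ^ 2 + b ^ 2) * (n * r ^ 2) := by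
    linear_combination (√a - √b) ^ 2 / 2 * hnr
  have e4 : (a ^ 2 + b ^ 2) * (n * r ^ 2) ≤ (a ^ 2 + b ^ 2) * √q :=
    mul_le_mul_of_nonneg_left (hnr2.trans hsq) (by positivity)
  have h8' : Real.log 8 ≤ Real.log 8 * √q :=
    le_mul_of_one_le_right (Real.log_nonneg (by norm_num)) hsq
  rw [e1, e2, e3, errorConst, IStar, ← hK]
  linarith

/-- The only use of q ≤ log n: it keeps the second-order terms n (q/n)² bounded and the edge
probabilities small. -/
theorem eventually_sq_le_natCast {q : ℕ → ℝ} (hq : Tendsto q atTop atTop)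
    (hqlog : ∀ᶠ n : ℕ in atTop, q n ≤ Real.log n) : ∀ᶠ n : ℕ in atTop, q n ^ 2 ≤ n := by
  have h := (Real.isLittleO_pow_log_id_atTop (n := 2)).bound one_pos
  have h' := tendsto_natCast_atTop_atTop (R := ℝ) |>.eventually h
  filter_upwards [h', hqlog, hq.eventually_ge_atTop 0] with n h1 h2 h3
  simp only [id, one_mul, Real.norm_eq_abs, abs_of_nonneg (sq_nonneg (Real.log n)),
    Nat.abs_cast] at h1
  exact (pow_le_pow_left₀ h3 h2 2).trans h1

theorem eventually_mul_div_le_half {q : ℕ → ℝ} (hq : Tendsto q atTop atTop)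
    (hq2 : ∀ᶠ n : ℕ in atTop, q n ^ 2 ≤ n) (a : ℝ) :
    ∀ᶠ n : ℕ in atTop, a * q n / n ≤ 1 / 2 := by
  filter_upwards [hq2, hq.eventually_ge_atTop (2 * a), hq.eventually_ge_atTop 1,
    eventually_gt_atTop 0] with n h1 h2 h3 h4
  have hn : (0 : ℝ) < n := by exact_mod_cast h4
  rw [div_le_iff₀ hn]
  nlinarith

end CSBM

theorem mainTheorem6 (a b c : ℝ) (ha : 0 < a) (hb : 0 < b) (hc : 0 < c)
    (q R : ℕ → ℝ) (d : ℕ → ℕ)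
    (hq : Tendsto q atTop atTop)
    (hqlog : ∀ᶠ n : ℕ in atTop, q n ≤ Real.log n)
    (hd : ∀ᶠ n in atTop, 2 ≤ d n)
    (hR : ∀ᶠ n in atTop, 0 < R n)
    (hSNR : ∀ᶠ n : ℕ in atTop, R n ^ 4 / (R n ^ 2 + (d n : ℝ) / n) = c * q n)
    (yhat : (n : ℕ) → CSBM.Adj n × CSBM.Attr n (d n) → CSBM.Labels n)
    (hyhat : ∀ n, Measurable (yhat n)) :
    ((-CSBM.IStar a b c : ℝ) : EReal) ≤
      liminf (fun n : ℕ => (((q n)⁻¹ : ℝ) : EReal) *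
        ENNReal.log (CSBM.risk n (d n) (a * q n / n) (b * q n / n) (R n) (yhat n))) atTop := by
  have hq2 := CSBM.eventually_sq_le_natCast hq hqlog
  -- After division by q the error √q in the exponent becomes 1/√q, so the explicit lower bounds
  -- converge to -I*.
  have hlim : Tendsto (fun n => ((-(CSBM.IStar a b c + CSBM.errorConst a b c * (√(q n))⁻¹) : ℝ) :
      EReal)) atTop (𝓝 ((-CSBM.IStar a b c : ℝ) : EReal)) := by
    refine (continuous_coe_real_ereal.tendsto _).comp ?_
    have h := (tendsto_inv_atTop_zero.comp (Real.tendsto_sqrt_atTop.comp hq)).const_mul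
      (CSBM.errorConst a b c)
    have h2 := (h.const_add (CSBM.IStar a b c)).neg
    simpa using h2
  rw [← hlim.liminf_eq]
  refine liminf_le_liminf ?_
  filter_upwards [hq2, hd, hR, hSNR, hq.eventually_ge_atTop 1, eventually_ge_atTop 2,
    CSBM.eventually_mul_div_le_half hq hq2 a, CSBM.eventually_mul_div_le_half hq hq2 b]
    with n h2 hdn hRn hSn hqn hn han hbn
  have hrisk := CSBM.risk_ge_exp ha hb hc (by omega) hn hqn hRn h2 han hbn hSn (hyhat n)
  have hq0 : 0 < q n := by linarith
  have hlog := ENNReal.log_monotone hrisk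
  rw [ENNReal.log_ofReal_of_pos (Real.exp_pos _), Real.log_exp] at hlog
  refine le_trans (le_of_eq ?_) (mul_le_mul_of_nonneg_left hlog
    (EReal.coe_nonneg.2 (inv_nonneg.2 hq0.le)))
  rw [← EReal.coe_mul]
  congr 1
  have hs : (√(q n))⁻¹ * q n = √(q n) := by
    rw [inv_mul_eq_div, Real.div_sqrt]
  rw [inv_mul_eq_div, eq_div_iff hq0.ne']
  linear_combination -CSBM.errorConst a b c * hs
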